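/- Let $\Delta\ge 3$ be an integer and $\lambda>0$. Put $\lambda_c(\mathbb{T}_\Delta)=(\Delta-1)^{\Delta-1}/(\Delta-2)^{\Delta}$. Let $T_\ell$ be the complete tree of degree $\Delta$ and depth $\ell$ (the root has $\Delta$ children, every other vertex at distance less than $\ell$ from the root has $\Delta-1$ children, and the leaves are at distance $\ell$ from the root), let $p_\ell$ be the probability that the root of $T_\ell$ belongs to a random independent set $I$ of $T_\ell$ drawn with probability proportional to $\lambda^{|I|}$, and let $p^+=\lim_{\ell\to\infty}p_{2\ell}$ and $p^-=\lim_{\ell\to\infty}p_{2\ell+1}$. With $0\ln 0=0$, let $H(x)=-x\ln x-(1-x)\ln(1-x)$, $H_1(x,y)=-x(\ln x-\ln y)+(x-y)(\ln(y-x)-\ln y)$, and \[ \begin{aligned} \Phi_2(\alpha,\beta,\gamma,\delta,\varepsilon)={}&2(\alpha+\beta)\ln\lambda+H(\alpha)+H_1(\gamma,\alpha)+H_1(\alpha-\gamma,1-\alpha)+H(\beta)+H_1(\delta,\beta)+H_1(\beta-\delta,1-\beta)\\ &+\Delta\Big(H_1(\gamma,1-2\beta+\delta)-H(\gamma)+H_1(\varepsilon,1-2\beta+\delta-\gamma)+H_1(\alpha-\gamma-\varepsilon,\beta-\delta)\\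 &\qquad-H_1(\alpha-\gamma,1-\gamma)+H_1(\alpha-\gamma,1-\beta-\gamma-\varepsilon)-H_1(\alpha-\gamma,1-\alpha)\Big). \end{aligned} \] Sly's Condition holds for $(\Delta,\lambda)$ if the limits $p^+$ and $p^-$ exist and there is a constant $\chi>0$ such that, whenever $|p^+-\alpha|<\chi$ and $|p^--\beta|<\chi$, the function $(\gamma,\delta,\varepsilon)\mapsto\Phi_2(\alpha,\beta,\gamma,\delta,\varepsilon)$ attains its unique maximum over the region given by \[ \begin{gathered} \gamma,\delta,\varepsilon\ge 0,\quad \alpha-\gamma-\varepsilon\ge 0,\quad \beta-\delta\ge 0,\quad 1-2\beta+\delta-\gamma-\varepsilon\ge 0,\\ 1-\alpha-\beta-\varepsilon\ge 0,\quad \beta-\delta+\varepsilon+\gamma-\alpha\ge 0 \end{gathered} \] at the point $(\alpha^2,\beta^2,\alpha(1-\alpha-\beta))$. Finally, let $\lambda_{1/2}(\mathbb{T}_\Delta)$ be the smallest $\lambda>0$ such that $\phi(\phi(1/2))=1/2$, where $\phi(x)=(1-x)\Big(1-\big(\tfrac{x}{\lambda(1-x)}\big)^{1/\Delta}\Big)$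 for $x\in[0,1)$ (so $\phi(1/2)\in[0,1)$ is required). Then Sly's Condition holds in each of the following cases: (1) $\Delta=3$ and $\lambda>\lambda_c(\mathbb{T}_3)=4$; (2) $\Delta\ge 6$ and $\lambda_c(\mathbb{T}_\Delta)<\lambda\le\lambda_{1/2}(\mathbb{T}_\Delta)$; moreover, for every $\Delta\ge 6$, $\lambda_{1/2}(\mathbb{T}_\Delta)$ exists and $\lambda_{1/2}(\mathbb{T}_\Delta)>\lambda_c(\mathbb{T}_{\Delta-1})$; (3) $\Delta=5$ and $\lambda_c(\mathbb{T}_5)<\lambda\le\lambda_c(\mathbb{T}_5)+0.402912$; (4) $\Delta=4$ and $\lambda_c(\mathbb{T}_4)<\lambda\le\lambda_c(\mathbb{T}_4)+0.327887$. -/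

import Mathlib

open Filter Topology

noncomputable section

namespace HardCore

/-! ### The hard-core model on a finite graph -/

section Gibbs

open scoped Classical in
/-- The partition function `Z_G(lam)`: the sum of `lam ^ |I|` over the independent sets `I`. -/
def partitionFunction {V : Type} [Fintype V] (G : SimpleGraph V) (lam : ℝ) : ℝ :=
  ∑ I ∈ Finset.univ.filter (fun I : Finset V => G.IsIndepSet (I : Set V)), lam ^ I.card

/-- The Gibbs weight `lam ^ |I| / Z_G(lam)` of an independent set `I`. -/
def gibbs {V : Type} [Fintype V] (G : SimpleGraph V) (lam : ℝ) (I : Finset V) : ℝ :=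
  lam ^ I.card / partitionFunction G lam

open scoped Classical in
/-- The marginal probability that the vertex `v` is occupied in the Gibbs distribution. -/
def occupation {V : Type} [Fintype V] (G : SimpleGraph V) (lam : ℝ) (v : V) : ℝ :=
  ∑ I ∈ Finset.univ.filter (fun I : Finset V => G.IsIndepSet (I : Set V) ∧ v ∈ I),
    gibbs G lam I

end Gibbs

/-! ### The complete tree of degree `Δ` with `l` levels below the root -/

/-- A vertex of the complete tree of degree `Δ` and depth `l` is the word of choices made on the
path from the root to it: `Δ` choices at the root, and `Δ - 1` choices at every later vertex. -/
def TreeVertex (Δ l : ℕ) : Type :=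
  {w : List (Fin Δ) // w.length ≤ l ∧ ∀ a ∈ w.tail, (a : ℕ) + 1 < Δ}

instance (Δ l : ℕ) : Finite (TreeVertex Δ l) :=
  ((List.finite_length_le (Fin Δ) l).subset (fun _ h => h.1)).to_subtype

instance (Δ l : ℕ) : Fintype (TreeVertex Δ l) := Fintype.ofFinite _

/-- The root is the empty word. -/
def treeRoot (Δ l : ℕ) : TreeVertex Δ l := ⟨[], by simp⟩

/-- Two vertices are adjacent when one of them is a child of the other, that is, when its word
extends the other one by one letter. -/
def completeTree (Δ l : ℕ) : SimpleGraph (TreeVertex Δ l) where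
  Adj u v := (∃ a, v.1 = u.1 ++ [a]) ∨ (∃ a, u.1 = v.1 ++ [a])
  symm := ⟨fun _ _ h => h.symm⟩
  loopless := ⟨fun u h => by
    rcases h with ⟨a, h⟩ | ⟨a, h⟩ <;> simp at h⟩

/-- `p_l`: the marginal probability that the root is occupied on the complete tree of depth `l`. -/
def rootOccupation (Δ : ℕ) (lam : ℝ) (l : ℕ) : ℝ :=
  occupation (completeTree Δ l) lam (treeRoot Δ l)

/-- The critical activity `(Δ - 1) ^ (Δ - 1) / (Δ - 2) ^ Δ` of the `Δ`-regular tree. -/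
def lambdaC (Δ : ℕ) : ℝ := ((Δ : ℝ) - 1) ^ (Δ - 1) / ((Δ : ℝ) - 2) ^ Δ

/-! ### The second moment exponent -/

/-- `H(x) = -x ln x - (1-x) ln (1-x)`. -/
def entropyH (x : ℝ) : ℝ := -x * Real.log x - (1 - x) * Real.log (1 - x)

/-- `H₁(x,y) = -x (ln x - ln y) + (x-y) (ln (y-x) - ln y)`, with `0 ln 0 = 0`. -/
def entropyH₁ (x y : ℝ) : ℝ :=
  -x * (Real.log x - Real.log y) + (x - y) * (Real.log (y - x) - Real.log y)

/-- The exponent `Φ₂(α,β,γ,δ,ε)` of the second moment. -/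
def Phi₂ (Δ : ℕ) (lam α β γ δ ε : ℝ) : ℝ :=
  2 * (α + β) * Real.log lam
    + entropyH α + entropyH₁ γ α + entropyH₁ (α - γ) (1 - α)
    + entropyH β + entropyH₁ δ β + entropyH₁ (β - δ) (1 - β)
    + (Δ : ℝ) * (entropyH₁ γ (1 - 2 * β + δ) - entropyH γ
      + entropyH₁ ε (1 - 2 * β + δ - γ)
      + entropyH₁ (α - γ - ε) (β - δ) - entropyH₁ (α - γ) (1 - γ)
      + entropyH₁ (α - γ) (1 - β - γ - ε) - entropyH₁ (α - γ) (1 - α))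

/-- The region of the triples `(γ,δ,ε)` on which `Φ₂(α,β,·,·,·)` is considered. -/
def region (α β : ℝ) : Set (ℝ × ℝ × ℝ) :=
  {x | 0 ≤ x.1 ∧ 0 ≤ x.2.1 ∧ 0 ≤ x.2.2 ∧
    0 ≤ α - x.1 - x.2.2 ∧ 0 ≤ β - x.2.1 ∧
    0 ≤ 1 - 2 * β + x.2.1 - x.1 - x.2.2 ∧
    0 ≤ 1 - α - β - x.2.2 ∧
    0 ≤ β - x.2.1 + x.2.2 + x.1 - α}

/-- `f` attains its unique maximum over `S` at the point `x₀` of `S`. -/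
def IsUniqueMaxOn {X : Type} (f : X → ℝ) (S : Set X) (x₀ : X) : Prop :=
  x₀ ∈ S ∧ ∀ x ∈ S, x ≠ x₀ → f x < f x₀

/-- Sly's condition at degree `Δ` and activity `lam`. The densities `p⁺` and `p⁻` are the limits
of the root marginals along the even and along the odd depths (that they exist is part of it). -/
def SlyCondition (Δ : ℕ) (lam : ℝ) : Prop :=
  ∃ pPlus pMinus : ℝ,
    Tendsto (fun l : ℕ => rootOccupation Δ lam (2 * l)) atTop (𝓝 pPlus) ∧
    Tendsto (fun l : ℕ => rootOccupation Δ lam (2 * l + 1)) atTop (𝓝 pMinus) ∧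
    ∃ χ > 0, ∀ α β : ℝ, |pPlus - α| < χ → |pMinus - β| < χ →
      IsUniqueMaxOn (fun x : ℝ × ℝ × ℝ => Phi₂ Δ lam α β x.1 x.2.1 x.2.2) (region α β)
        (α ^ 2, β ^ 2, α * (1 - α - β))

/-! ### The activity `λ_{1/2}` -/

/-- `φ(x) = (1-x) (1 - (x / (lam (1-x))) ^ (1/Δ))`, a function on `[0,1)`. -/
def phi (Δ : ℕ) (lam x : ℝ) : ℝ :=
  (1 - x) * (1 - (x / (lam * (1 - x))) ^ ((1 : ℝ) / (Δ : ℝ)))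

/-- `L` is `λ_{1/2}(T_Δ)`, the smallest activity `lam > 0` with `φ(φ(1/2)) = 1/2`, where `φ(1/2)`
has to lie in the domain `[0,1)` of `φ`. -/
def IsLambdaHalf (Δ : ℕ) (L : ℝ) : Prop :=
  IsLeast {lam : ℝ | 0 < lam ∧ phi Δ lam (1 / 2) ∈ Set.Ico (0 : ℝ) 1 ∧
    phi Δ lam (phi Δ lam (1 / 2)) = 1 / 2} L

end HardCore

end

namespace HardCore

/-! Sly's Condition holds for every Δ ≥ 3 and every λ > λ_c. Write d = Δ - 1. Classify an edge by
whether the first independent set occupies its plus end (mass α), its minus end (mass β) or neither,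
and let q₁, q₂, q₃ be the densities of the second set conditional on the class. Then Φ₂ equals
Φ₁(α,β) + αΦ₁(q₁) + βΦ₁(q₂) + (1-α-β)Φ₁(q₃), where Φ₁ is the first moment exponent, minus d times
two terms that are nonnegative because entropy is concave (`Phi₂_eq`, `entropyH₁_add_le`). The qᵢ
average to (α,β); at the product point they all equal (α,β) and the two corrections vanish
(`Phi₂_product`). It remains to prove a strict Jensen inequality for Φ₁ at (α,β).

Φ₁ is not concave, but Jensen holds near (p⁺,p⁻) (`exists_strict_jensen`). This point maximizes Φ₁;
the only other maximizer is its swap, which has a smaller first coordinate and so cannot enter an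
average equal to (p⁺,p⁻); and the second derivative at (p⁺,p⁻) is negative definite.

These facts come from the recursion z ↦ λ/(1+z)^d. A maximizer of Φ₁ is an interior critical point,
hence a fixed point or a two-cycle of the recursion, and the second derivative test excludes fixed
points when λ > λ_c. The two-cycle is unique and stable, both by the single inequality
`pow_sub_one_mul_lower_bound`. Uniqueness identifies the maximizer with the limits of the root
marginals; stability is the determinant condition on the second derivative.

For λ_{1/2}, the substitution λ = u^(-Δ) turns the equation into (1-u)(1+u)^d = 1, whose largest
root gives the smallest activity. -/

/-! ### Two-cycles of the tree recursion -/

/-- `1 + r² + ⋯ + r ^ (2 (m-1)) ≥ m r ^ (m-1)`, cleared of denominators. -/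
theorem mul_pow_le_pow_sub_one {r : ℝ} (hr : 1 < r) :
    ∀ m : ℕ, (m : ℝ) * r ^ m * (r ^ 2 - 1) ≤ r * ((r ^ 2) ^ m - 1)
  | 0 => by simp
  | 1 => by simp
  | m + 2 => by
    have ih := mul_pow_le_pow_sub_one hr m
    -- Multiplying the inequality for m by r² and subtracting it from the one for m + 2 leaves
    -- exactly r times this square term.
    have h1 : 0 ≤ (r ^ 2 - 1) * (r ^ (m + 1) - 1) ^ 2 :=
      mul_nonneg (by nlinarith) (sq_nonneg _)
    push_cast
    have e : (r ^ 2) ^ m = r ^ m * r ^ m := by rw [← pow_mul, two_mul, pow_add]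
    have e2 : (r ^ 2) ^ (m + 2) = r ^ m * r ^ m * r ^ 4 := by rw [pow_add, e]; ring
    rw [e] at ih
    rw [e2]
    have h2 := mul_le_mul_of_nonneg_left ih (sq_nonneg r)
    have h3 := mul_nonneg (by positivity : (0 : ℝ) ≤ r) h1
    ring_nf at h2 h3 ⊢
    nlinarith

/-- The square gained in the induction step is positive, so only the exponents 0 and 1 give
equality. -/
theorem mul_pow_lt_pow_sub_one {r : ℝ} (hr : 1 < r) (m : ℕ) :
    ((m + 2 : ℕ) : ℝ) * r ^ (m + 2) * (r ^ 2 - 1) < r * ((r ^ 2) ^ (m + 2) - 1) := by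
  have ih := mul_pow_le_pow_sub_one hr m
  have hp : 1 < r ^ (m + 1) := one_lt_pow₀ hr (by omega)
  have h1 : 0 < (r ^ 2 - 1) * (r ^ (m + 1) - 1) ^ 2 :=
    mul_pos (by nlinarith) (by have : r ^ (m + 1) - 1 > 0 := by linarith
                               positivity)
  push_cast
  have e : (r ^ 2) ^ m = r ^ m * r ^ m := by rw [← pow_mul, two_mul, pow_add]
  have e2 : (r ^ 2) ^ (m + 2) = r ^ m * r ^ m * r ^ 4 := by rw [pow_add, e]; ring
  rw [e] at ih
  rw [e2]
  have h2 := mul_le_mul_of_nonneg_left ih (sq_nonneg r)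
  have h3 := mul_pos (by positivity : (0 : ℝ) < r) h1
  ring_nf at h2 h3 ⊢
  nlinarith

/-- With s = r², this is the product of the preceding inequalities at the exponents m and m + 2.
Both the stability and the uniqueness of two-cycles rest on it. -/
theorem pow_sub_one_mul_lower_bound {s : ℝ} (hs : 1 < s) {m : ℕ} (hm : 1 ≤ m) :
    (m : ℝ) * (m + 2) * s ^ m * (s - 1) ^ 2 < (s ^ m - 1) * (s ^ 2 * s ^ m - 1) := by
  obtain ⟨r, hr, rfl⟩ : ∃ r : ℝ, 1 < r ∧ r ^ 2 = s :=
    ⟨√s, by rw [Real.lt_sqrt] <;> linarith, Real.sq_sqrt (by linarith)⟩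
  have h1 := mul_pow_le_pow_sub_one hr m
  have h2 := mul_pow_lt_pow_sub_one hr m
  have hm' : (0 : ℝ) < m := by exact_mod_cast hm
  have h0 : 0 < (m : ℝ) * r ^ m * (r ^ 2 - 1) :=
    mul_pos (by positivity) (by nlinarith)
  have h4 : (m : ℝ) * r ^ m * (r ^ 2 - 1) * (((m + 2 : ℕ) : ℝ) * r ^ (m + 2) * (r ^ 2 - 1))
      < r * ((r ^ 2) ^ m - 1) * (r * ((r ^ 2) ^ (m + 2) - 1)) :=
    mul_lt_mul' h1 h2 (mul_nonneg (by positivity) (by nlinarith)) (lt_of_lt_of_le h0 h1)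
  have hr2 : 0 < r ^ 2 := by positivity
  refine lt_of_mul_lt_mul_left ?_ hr2.le
  have e : (r ^ 2) ^ m = r ^ m * r ^ m := by rw [← pow_mul, two_mul, pow_add]
  have e2 : (r ^ 2) ^ (m + 2) = r ^ m * r ^ m * r ^ 4 := by rw [pow_add, e]; ring
  rw [e, e2] at h4
  rw [e]
  push_cast at h4
  ring_nf at h4 ⊢
  linarith

/-- `x > y` are the two values of a two-cycle of `z ↦ lam / (1 + z) ^ d`. -/
structure IsTwoCycle (d : ℕ) (lam x y : ℝ) : Prop where
  pos : 0 < y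
  lt : y < x
  left : x * (1 + y) ^ d = lam
  right : y * (1 + x) ^ d = lam

namespace IsTwoCycle

variable {d : ℕ} {lam x y : ℝ}

/-- Dividing the two cycle equations gives x/y = s^(m+1) for s = (1+x)/(1+y). Together with 1 + x =
s(1+y) this is a linear system that expresses x and y through s. -/
theorem param {m : ℕ} (h : IsTwoCycle (m + 1) lam x y) :
    1 < (1 + x) / (1 + y) ∧
    x * (((1 + x) / (1 + y)) ^ m - 1) = ((1 + x) / (1 + y)) ^ m * ((1 + x) / (1 + y) - 1) ∧
    y * ((1 + x) / (1 + y)) * (((1 + x) / (1 + y)) ^ m - 1) = (1 + x) / (1 + y) - 1 := by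
  obtain ⟨hy, hxy, h1, h2⟩ := h
  have hy1 : 0 < 1 + y := by linarith
  have hx : x = y * ((1 + x) / (1 + y)) ^ (m + 1) := by
    rw [div_pow]
    field_simp
    linarith
  have hx1 : 1 + x = (1 + x) / (1 + y) * (1 + y) := by field_simp
  have hs : 1 < (1 + x) / (1 + y) := by rw [lt_div_iff₀ hy1]; linarith
  generalize (1 + x) / (1 + y) = s at *
  have e : s ^ (m + 1) = s * s ^ m := by ring
  rw [e] at hx
  have h3 : y * s * (s ^ m - 1) = s - 1 := by linarith
  refine ⟨hs, ?_, h3⟩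
  have : x * (s ^ m - 1) = s ^ m * (y * s * (s ^ m - 1)) := by
    rw [hx]; ring
  rw [this, h3]

/-- The product of the slopes along a two-cycle is less than one. -/
theorem stable (hd : 2 ≤ d) (h : IsTwoCycle d lam x y) :
    ((d : ℝ) ^ 2 - 1) * (x * y) < 1 + x + y := by
  obtain ⟨m, rfl⟩ : ∃ m, d = m + 1 := ⟨d - 1, by omega⟩
  obtain ⟨hs, hx, hy⟩ := h.param
  have hy0 := h.pos
  have hx1 : 1 + x = (1 + x) / (1 + y) * (1 + y) := by field_simp
  generalize (1 + x) / (1 + y) = s at *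
  have key := pow_sub_one_mul_lower_bound hs (m := m) (by omega)
  have hA : 1 < s ^ m := one_lt_pow₀ hs (by omega)
  generalize s ^ m = A at *
  have hA1 : A - 1 ≠ 0 := by linarith
  have hs0 : s ≠ 0 := by linarith
  have ex : x = A * (s - 1) / (A - 1) := by field_simp; linarith
  have ey : y = (s - 1) / (s * (A - 1)) := by field_simp; linarith
  have hpos : 0 < s * (A - 1) ^ 2 := by
    have : 0 < A - 1 := by linarith
    positivity
  -- In the parameter s, the stability gap is a positive multiple of the gap in
  -- `pow_sub_one_mul_lower_bound`.
  have e : s * (A - 1) ^ 2 * (1 + x + y - (((m + 1 : ℕ) : ℝ) ^ 2 - 1) * (x * y))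
      = (A - 1) * (s ^ 2 * A - 1) - m * (m + 2) * A * (s - 1) ^ 2 := by
    rw [ex, ey]
    push_cast
    field_simp
    ring
  have : 0 < 1 + x + y - (((m + 1 : ℕ) : ℝ) ^ 2 - 1) * (x * y) := by
    by_contra hc
    push Not at hc
    nlinarith [mul_nonneg hpos.le (neg_nonneg.2 hc)]
  linarith

end IsTwoCycle

/-- The logarithm of the activity of the two-cycle with `1 + x = s (1 + y)`. -/
noncomputable def logActivity (m : ℕ) (s : ℝ) : ℝ :=
  Real.log (s - 1) + (m + 1) * Real.log (s * s ^ m - 1) - Real.log s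
    - (m + 2) * Real.log (s ^ m - 1)

/-- The numerator of the derivative is again the gap in `pow_sub_one_mul_lower_bound`. Monotonicity
makes λ determine s, hence the whole cycle. -/
theorem logActivity_strictMonoOn {m : ℕ} (hm : 1 ≤ m) :
    StrictMonoOn (logActivity m) (Set.Ioi 1) := by
  have hder : ∀ s ∈ Set.Ioi (1 : ℝ), ∃ f', HasDerivAt (logActivity m) f' s ∧ 0 < f' := by
    intro s hs
    have hs : 1 < s := hs
    have hA : 1 < s ^ m := one_lt_pow₀ hs (by omega)
    have hsA : 1 < s * s ^ m := by nlinarith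
    have d1 : HasDerivAt (fun s : ℝ => Real.log (s - 1)) (1 / (s - 1)) s :=
      ((hasDerivAt_id' s).sub_const 1).log (by linarith)
    have dm : HasDerivAt (fun s : ℝ => s ^ m) (m * s ^ m / s) s := by
      refine (hasDerivAt_pow m s).congr_deriv ?_
      obtain ⟨k, rfl⟩ : ∃ k, m = k + 1 := ⟨m - 1, by omega⟩
      rw [Nat.add_sub_cancel, pow_succ]
      field_simp
    have d2 : HasDerivAt (fun s : ℝ => ((m : ℝ) + 1) * Real.log (s * s ^ m - 1))
        ((m + 1) * ((1 * s ^ m + s * (m * s ^ m / s)) / (s * s ^ m - 1))) s :=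
      ((((hasDerivAt_id' s).mul dm).sub_const 1).log (by simp; linarith)).const_mul _
    have d3 := Real.hasDerivAt_log (by linarith : s ≠ 0)
    have d4 := ((dm.sub_const 1).log (by linarith)).const_mul ((m : ℝ) + 2)
    have key := pow_sub_one_mul_lower_bound hs hm
    refine ⟨_, ((d1.add d2).sub d3).sub d4, ?_⟩
    generalize s ^ m = A at *
    have h1 : 0 < s - 1 := by linarith
    have h2 : 0 < s * A - 1 := by linarith
    have h3 : 0 < A - 1 := by linarith
    have h4 : 0 < s := by linarith
    have e : 1 / (s - 1) + ((m : ℝ) + 1) * ((1 * A + s * (m * A / s)) / (s * A - 1)) - s⁻¹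
        - (m + 2) * (m * A / s / (A - 1))
        = ((A - 1) * (s ^ 2 * A - 1) - m * (m + 2) * A * (s - 1) ^ 2)
          / (s * (s - 1) * (s * A - 1) * (A - 1)) := by
      field_simp
      ring
    rw [e]
    apply div_pos (by linarith) (by positivity)
  apply strictMonoOn_of_deriv_pos (convex_Ioi 1)
  · intro s hs
    obtain ⟨f', h, -⟩ := hder s hs
    exact h.continuousAt.continuousWithinAt
  · intro s hs
    rw [interior_Ioi] at hs
    obtain ⟨f', h, h'⟩ := hder s hs
    rwa [h.deriv]

namespace IsTwoCycle

variable {d : ℕ} {lam x y x' y' : ℝ}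

theorem log_eq_logActivity {m : ℕ} (hm : 1 ≤ m) (h : IsTwoCycle (m + 1) lam x y) :
    Real.log lam = logActivity m ((1 + x) / (1 + y)) := by
  obtain ⟨hs, hx, hy⟩ := h.param
  have hl := h.left
  have hy0 := h.pos
  have hx1 : 1 + x = (1 + x) / (1 + y) * (1 + y) := by field_simp
  generalize (1 + x) / (1 + y) = s at *
  have hA : 1 < s ^ m := one_lt_pow₀ hs (by omega)
  have hsA : 1 < s * s ^ m := by nlinarith
  have h1 : 0 < s - 1 := by linarith
  have h3 : 0 < s ^ m - 1 := by linarith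
  have h4 : 0 < s := by linarith
  have h5 : 0 < s * s ^ m - 1 := by linarith
  have ex : x = s ^ m * (s - 1) / (s ^ m - 1) := by field_simp; linarith
  have ey : 1 + y = (s * s ^ m - 1) / (s * (s ^ m - 1)) := by
    field_simp
    nlinarith
  have h6 : s ^ m ≠ 0 := by positivity
  rw [← hl, ex, ey, Real.log_mul (by positivity) (by positivity), Real.log_pow,
    Real.log_div (by positivity) h3.ne', Real.log_mul h6 h1.ne', Real.log_pow,
    Real.log_div h5.ne' (by positivity), Real.log_mul h4.ne' h3.ne', logActivity]
  push_cast
  ring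

/-- There is at most one two-cycle. -/
theorem unique (hd : 2 ≤ d) (h : IsTwoCycle d lam x y) (h' : IsTwoCycle d lam x' y') :
    x = x' ∧ y = y' := by
  obtain ⟨m, rfl⟩ : ∃ m, d = m + 1 := ⟨d - 1, by omega⟩
  have hm : 1 ≤ m := by omega
  obtain ⟨hs, hx, hy⟩ := h.param
  obtain ⟨hs', hx', hy'⟩ := h'.param
  have e : (1 + x) / (1 + y) = (1 + x') / (1 + y') :=
    (logActivity_strictMonoOn hm).injOn hs hs'
      (by rw [← h.log_eq_logActivity hm, ← h'.log_eq_logActivity hm])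
  rw [← e] at hx' hy'
  generalize (1 + x) / (1 + y) = s at *
  have hA : 1 < s ^ m := one_lt_pow₀ hs (by omega)
  have h3 : s ^ m - 1 ≠ 0 := by linarith
  have h4 : s ≠ 0 := by linarith
  exact ⟨mul_right_cancel₀ h3 (hx.trans hx'.symm),
    mul_right_cancel₀ h4 (mul_right_cancel₀ h3 (hy.trans hy'.symm))⟩

end IsTwoCycle

/-! ### Partition functions of trees -/

section RootedSum

open scoped Classical in
/-- The weight of a configuration: zero unless the occupied vertices are independent. -/
noncomputable def configWeight {V : Type} [Fintype V] (G : SimpleGraph V) (lam : ℝ)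
    (σ : V → Bool) : ℝ :=
  if ∀ u v, G.Adj u v → ¬(σ u = true ∧ σ v = true) then ∏ v, (if σ v then lam else 1) else 0

/-- The contribution to the partition function of the configurations with value `b` at `r`. -/
noncomputable def rootedSum {V : Type} [Fintype V] [DecidableEq V] (G : SimpleGraph V) (lam : ℝ)
    (r : V) (b : Bool) : ℝ :=
  ∑ σ : V → Bool, if σ r = b then configWeight G lam σ else 0

/-- A set of vertices as a configuration. -/
def finsetEquivConfig (V : Type) [Fintype V] [DecidableEq V] : Finset V ≃ (V → Bool) where
  toFun I v := decide (v ∈ I)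
  invFun σ := Finset.univ.filter (fun v => σ v = true)
  left_inv I := by ext; simp
  right_inv σ := by ext; simp

variable {V : Type} [Fintype V] [DecidableEq V] (G : SimpleGraph V) (lam : ℝ)

theorem configWeight_finset (I : Finset V) [Decidable (G.IsIndepSet (I : Set V))] :
    configWeight G lam (finsetEquivConfig V I)
      = if G.IsIndepSet (I : Set V) then lam ^ I.card else 0 := by
  have h : (∀ u v, G.Adj u v → ¬(finsetEquivConfig V I u = true ∧ finsetEquivConfig V I v = true))
      ↔ G.IsIndepSet (I : Set V) := by
    simp only [finsetEquivConfig, Equiv.coe_fn_mk, decide_eq_true_eq]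
    constructor
    · intro h u hu v hv _ huv
      exact h u v huv ⟨hu, hv⟩
    · rintro h u v huv ⟨hu, hv⟩
      exact h hu hv huv.ne huv
  simp only [configWeight, h]
  congr 1
  simp [finsetEquivConfig]

theorem partitionFunction_eq_rootedSum (r : V) :
    partitionFunction G lam = rootedSum G lam r true + rootedSum G lam r false := by
  classical
  rw [partitionFunction, Finset.sum_filter, rootedSum, rootedSum, ← Finset.sum_add_distrib]
  refine Fintype.sum_equiv (finsetEquivConfig V) _ _ fun I => ?_
  rw [configWeight_finset]
  cases finsetEquivConfig V I r <;> simp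

theorem occupation_eq_rootedSum (r : V) :
    occupation G lam r
      = rootedSum G lam r true / (rootedSum G lam r true + rootedSum G lam r false) := by
  classical
  rw [← partitionFunction_eq_rootedSum, occupation]
  simp only [gibbs]
  rw [← Finset.sum_div, Finset.sum_filter, rootedSum]
  congr 1
  refine Fintype.sum_equiv (finsetEquivConfig V) _ _ fun I => ?_
  rw [configWeight_finset]
  by_cases h : r ∈ I <;> simp [finsetEquivConfig, h]

theorem rootedSum_false_pos (hlam : 0 < lam) (r : V) : 0 < rootedSum G lam r false := by
  classical
  have h0 : ∀ σ, 0 ≤ configWeight G lam σ := by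
    intro σ
    rw [configWeight]
    split_ifs
    · exact Finset.prod_nonneg fun v _ => by split_ifs <;> linarith
    · exact le_rfl
  refine Finset.sum_pos' (fun σ _ => ?_) ⟨fun _ => false, Finset.mem_univ _, ?_⟩
  · split_ifs
    · exact h0 σ
    · exact le_rfl
  · simp [configWeight]

theorem rootedSum_iso {V' : Type} [Fintype V'] [DecidableEq V'] {G : SimpleGraph V}
    {G' : SimpleGraph V'} (e : G ≃g G') {r : V} {r' : V'} (hr : e r = r') (b : Bool) :
    rootedSum G lam r b = rootedSum G' lam r' b := by
  subst hr
  refine Fintype.sum_equiv (e.toEquiv.arrowCongr (Equiv.refl Bool)) _ _ fun σ => ?_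
  have h1 : ∀ v, (e.toEquiv.arrowCongr (Equiv.refl Bool)) σ (e v) = σ v := by
    intro v
    exact congrArg σ (e.symm_apply_apply v)
  rw [h1]
  congr 1
  unfold configWeight
  congr 1
  · apply propext
    constructor
    · intro h u v huv
      obtain ⟨u, rfl⟩ := e.surjective u
      obtain ⟨v, rfl⟩ := e.surjective v
      rw [h1, h1]
      exact h u v (e.map_adj_iff.1 huv)
    · intro h u v huv
      have := h (e u) (e v) (e.map_adj_iff.2 huv)
      rwa [h1, h1] at this
  · refine Fintype.prod_equiv e.toEquiv _ _ fun v => ?_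
    exact (congrArg (fun b : Bool => if b = true then lam else 1) (h1 v)).symm

/-! ### Joining rooted graphs under a new root -/

/-- Copies of `G`, one for every element of `ι`, whose roots `r` are the children of a new root. -/
def rootJoin (ι : Type) (G : SimpleGraph V) (r : V) : SimpleGraph (Option (ι × V)) where
  Adj
    | none, none => False
    | none, some p => p.2 = r
    | some p, none => p.2 = r
    | some p, some q => p.1 = q.1 ∧ G.Adj p.2 q.2
  symm := ⟨by
    rintro (_ | p) (_ | q) h
    · exact h
    · exact h
    · exact h
    · exact ⟨h.1.symm, h.2.symm⟩⟩
  loopless := ⟨by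
    rintro (_ | p) h
    · exact h
    · exact G.loopless.irrefl _ h.2⟩

/-- A configuration on the join is a value at the root and a configuration on every copy. -/
def joinConfigEquiv (ι V : Type) : (Option (ι × V) → Bool) ≃ Bool × (ι → V → Bool) where
  toFun σ := (σ none, fun i v => σ (some (i, v)))
  invFun p
    | none => p.1
    | some q => p.2 q.1 q.2
  left_inv σ := by ext (_ | _) <;> rfl
  right_inv p := rfl

variable {ι : Type} [Fintype ι] [DecidableEq ι]

/-- Independence on the join means independence on each copy and, when the new root is occupied,
vacancy of every old root; the weight therefore factors over the copies. -/
theorem configWeight_rootJoin (r : V) (b : Bool) (τ : ι → V → Bool) :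
    configWeight (rootJoin ι G r) lam ((joinConfigEquiv ι V).symm (b, τ))
      = if b then lam * ∏ i, (if τ i r = false then configWeight G lam (τ i) else 0)
        else ∏ i, configWeight G lam (τ i) := by
  classical
  have h : (∀ u v, (rootJoin ι G r).Adj u v → ¬((joinConfigEquiv ι V).symm (b, τ) u = true
      ∧ (joinConfigEquiv ι V).symm (b, τ) v = true))
      ↔ (∀ i ∈ (Finset.univ : Finset ι), ∀ u v, G.Adj u v → ¬(τ i u = true ∧ τ i v = true))
        ∧ (b = true → ∀ i ∈ (Finset.univ : Finset ι), τ i r = false) := by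
    constructor
    · intro h
      refine ⟨fun i _ u v huv => h (some (i, u)) (some (i, v)) ⟨rfl, huv⟩, fun hb i _ => ?_⟩
      have := h none (some (i, r)) rfl
      by_contra hc
      exact this ⟨hb, Bool.eq_true_of_not_eq_false hc⟩
    · rintro ⟨h1, h2⟩ (_ | ⟨i, u⟩) (_ | ⟨j, v⟩) huv ⟨hu, hv⟩
      · exact huv
      · obtain rfl : v = r := huv
        have := h2 hu j (Finset.mem_univ _)
        exact absurd (hv.symm.trans this) (by simp)
      · obtain rfl : u = r := huv
        have := h2 hv i (Finset.mem_univ _)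
        exact absurd (hu.symm.trans this) (by simp)
      · obtain ⟨hij, huv⟩ := huv
        obtain rfl : i = j := hij
        exact h1 i (Finset.mem_univ _) u v huv ⟨hu, hv⟩
  have h3 : (∏ x, if (joinConfigEquiv ι V).symm (b, τ) x = true then lam else 1)
      = (if b then lam else 1) * ∏ i, ∏ v, if τ i v = true then lam else 1 := by
    rw [Fintype.prod_option, Fintype.prod_prod_type]
    rfl
  rw [configWeight, h3]
  simp only [h]
  unfold configWeight
  simp only [← ite_and, Finset.prod_ite_zero]
  cases b
  · simp
  · simp only [if_true, mul_ite, mul_zero]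
    congr 1
    apply propext
    constructor
    · rintro ⟨h1, h2⟩ i hi
      exact ⟨h2 trivial i hi, h1 i hi⟩
    · intro h
      exact ⟨fun i hi => (h i hi).2, fun _ i hi => (h i hi).1⟩

theorem sum_prod_eq_pow (f : (V → Bool) → ℝ) :
    ∑ τ : ι → V → Bool, ∏ i, f (τ i) = (∑ σ, f σ) ^ Fintype.card ι := by
  classical
  have := Finset.prod_univ_sum (fun _ : ι => (Finset.univ : Finset (V → Bool))) (fun _ σ => f σ)
  rw [Fintype.piFinset_univ] at this
  rw [← this, Finset.prod_const, Finset.card_univ]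

theorem rootedSum_rootJoin_true (r : V) :
    rootedSum (rootJoin ι G r) lam none true
      = lam * rootedSum G lam r false ^ Fintype.card ι := by
  rw [rootedSum, ← (joinConfigEquiv ι V).symm.sum_comp, Fintype.sum_prod_type]
  simp only [Fintype.sum_bool, configWeight_rootJoin]
  have h : ∀ b τ, (joinConfigEquiv ι V).symm (b, τ) none = b := fun _ _ => rfl
  simp only [h, if_true, Bool.false_eq_true, if_false, Finset.sum_const_zero, add_zero]
  rw [← Finset.mul_sum,
    sum_prod_eq_pow (fun σ => if σ r = false then configWeight G lam σ else 0)]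
  rfl

theorem rootedSum_rootJoin_false (r : V) :
    rootedSum (rootJoin ι G r) lam none false
      = (rootedSum G lam r true + rootedSum G lam r false) ^ Fintype.card ι := by
  rw [rootedSum, ← (joinConfigEquiv ι V).symm.sum_comp, Fintype.sum_prod_type]
  simp only [Fintype.sum_bool, configWeight_rootJoin]
  have h : ∀ b τ, (joinConfigEquiv ι V).symm (b, τ) none = b := fun _ _ => rfl
  simp only [h, if_true, Bool.true_eq_false, Bool.false_eq_true, if_false, Finset.sum_const_zero,
    zero_add]
  rw [sum_prod_eq_pow, rootedSum, rootedSum, ← Finset.sum_add_distrib]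
  congr 1
  refine Finset.sum_congr rfl fun σ _ => ?_
  cases σ r <;> simp

end RootedSum

/-! ### Trees of words -/

/-- Words are adjacent when one extends the other by one letter. -/
def wordGraph (α : Type) : SimpleGraph (List α) where
  Adj u v := (∃ a, v = u ++ [a]) ∨ (∃ a, u = v ++ [a])
  symm := ⟨fun _ _ h => h.symm⟩
  loopless := ⟨fun u h => by rcases h with ⟨a, h⟩ | ⟨a, h⟩ <;> simp at h⟩

/-- A tree of words as the join of the subtrees below the children of its root. -/
def wordGraphIso {α : Type} {p q : List α → Prop} {S : α → Prop} (hp : p []) (hq : q [])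
    (h : ∀ a t, p (a :: t) ↔ S a ∧ q t) :
    (wordGraph α).comap (Subtype.val : {w // p w} → List α) ≃g
      rootJoin {a // S a} ((wordGraph α).comap (Subtype.val : {w // q w} → List α)) ⟨[], hq⟩ where
  toFun
    | ⟨[], _⟩ => none
    | ⟨a :: t, ht⟩ => some (⟨a, ((h a t).1 ht).1⟩, ⟨t, ((h a t).1 ht).2⟩)
  invFun
    | none => ⟨[], hp⟩
    | some x => ⟨x.1.1 :: x.2.1, (h _ _).2 ⟨x.1.2, x.2.2⟩⟩
  left_inv := by rintro ⟨_ | ⟨a, t⟩, ht⟩ <;> rfl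
  right_inv := by rintro (_ | ⟨⟨a, ha⟩, ⟨t, ht⟩⟩) <;> rfl
  map_rel_iff' := by
    rintro ⟨_ | ⟨a, u⟩, hu⟩ ⟨_ | ⟨b, v⟩, hv⟩
    · simp [rootJoin, wordGraph]
    · simp [rootJoin, wordGraph]
    · simp [rootJoin, wordGraph]
    · simp only [rootJoin, wordGraph, Equiv.coe_fn_mk, SimpleGraph.comap_adj, Subtype.mk.injEq,
        List.cons_append, List.cons.injEq, exists_and_left]
      constructor
      · rintro ⟨rfl, h | h⟩
        · exact Or.inl ⟨rfl, h⟩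
        · exact Or.inr ⟨rfl, h⟩
      · rintro (⟨rfl, h⟩ | ⟨rfl, h⟩)
        · exact ⟨rfl, Or.inl h⟩
        · exact ⟨rfl, Or.inr h⟩

/-- The words of the tree with `Δ - 1` children at every vertex, the root included. -/
def IsBranchWord (Δ l : ℕ) (w : List (Fin Δ)) : Prop :=
  w.length ≤ l ∧ ∀ a ∈ w, (a : ℕ) + 1 < Δ

theorem isBranchWord_nil (Δ l : ℕ) : IsBranchWord Δ l [] := by simp [IsBranchWord]

instance (Δ l : ℕ) : Finite {w : List (Fin Δ) // IsBranchWord Δ l w} :=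
  ((List.finite_length_le (Fin Δ) l).subset (fun _ h => h.1)).to_subtype

noncomputable instance (Δ l : ℕ) : Fintype {w : List (Fin Δ) // IsBranchWord Δ l w} :=
  Fintype.ofFinite _

/-- The tree with `Δ - 1` children at every vertex, the root included. -/
def branchTree (Δ l : ℕ) : SimpleGraph {w : List (Fin Δ) // IsBranchWord Δ l w} :=
  (wordGraph (Fin Δ)).comap Subtype.val

/-- The ratio of the occupied and the vacant partition functions of the branch. -/
noncomputable def branchRatio (Δ : ℕ) (lam : ℝ) (l : ℕ) : ℝ :=
  rootedSum (branchTree Δ l) lam ⟨[], isBranchWord_nil Δ l⟩ true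
    / rootedSum (branchTree Δ l) lam ⟨[], isBranchWord_nil Δ l⟩ false

theorem branchRatio_zero (Δ : ℕ) (lam : ℝ) : branchRatio Δ lam 0 = lam := by
  -- A single vertex is the join of an empty family, so the choice of subtree does not matter.
  have h1 := fun b => rootedSum_iso lam (G := branchTree Δ 0) (wordGraphIso (p := IsBranchWord Δ 0)
    (q := IsBranchWord Δ 0) (S := fun _ => False)
    (isBranchWord_nil Δ 0) (isBranchWord_nil Δ 0) (by simp [IsBranchWord]))
    (r := ⟨[], isBranchWord_nil Δ 0⟩) (r' := none) rfl b
  rw [branchRatio, h1, h1, rootedSum_rootJoin_true, rootedSum_rootJoin_false]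
  simp

theorem branchRatio_succ {Δ : ℕ} (hΔ : 1 ≤ Δ) {lam : ℝ} (hlam : 0 < lam) (l : ℕ) :
    branchRatio Δ lam (l + 1) = lam / (1 + branchRatio Δ lam l) ^ (Δ - 1) := by
  have h1 := fun b => rootedSum_iso lam (G := branchTree Δ (l + 1))
    (wordGraphIso (p := IsBranchWord Δ (l + 1))
    (q := IsBranchWord Δ l) (S := fun a => (a : ℕ) + 1 < Δ)
    (isBranchWord_nil Δ _) (isBranchWord_nil Δ l) (by simp [IsBranchWord]; tauto))
    (r := ⟨[], isBranchWord_nil Δ (l + 1)⟩) (r' := none) rfl b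
  have hpos := rootedSum_false_pos (branchTree Δ l) lam hlam ⟨[], isBranchWord_nil Δ l⟩
  have hcard : Fintype.card {a : Fin Δ // (a : ℕ) + 1 < Δ} = Δ - 1 := by
    obtain ⟨d, rfl⟩ : ∃ d, Δ = d + 1 := ⟨Δ - 1, by omega⟩
    rw [Fintype.card_subtype]
    have : (Finset.univ.filter fun a : Fin (d + 1) => (a : ℕ) + 1 < d + 1)
        = Finset.univ.erase (Fin.last d) := by
      ext a
      simp [Fin.ext_iff]
      omega
    rw [this, Finset.card_erase_of_mem (Finset.mem_univ _)]
    simp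
  rw [branchRatio, h1, h1, rootedSum_rootJoin_true, rootedSum_rootJoin_false, hcard, branchRatio]
  change lam * rootedSum (branchTree Δ l) lam _ _ ^ _
    / (rootedSum (branchTree Δ l) lam _ _ + rootedSum (branchTree Δ l) lam _ _) ^ _ = _
  generalize rootedSum (branchTree Δ l) lam _ true = A at *
  generalize rootedSum (branchTree Δ l) lam _ false = B at *
  rw [one_add_div hpos.ne', div_pow, add_comm A B, div_div_eq_mul_div]

/-- The root carries Δ branches, one more than any vertex inside a branch; this is why the exponent
is Δ here and Δ - 1 in `branchRatio_succ`. -/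
theorem rootOccupation_succ (Δ : ℕ) {lam : ℝ} (hlam : 0 < lam) (l : ℕ) :
    rootOccupation Δ lam (l + 1) = lam / (lam + (1 + branchRatio Δ lam l) ^ Δ) := by
  classical
  have h1 := fun b => rootedSum_iso lam (G := completeTree Δ (l + 1))
    (wordGraphIso (p := fun w : List (Fin Δ) => w.length ≤ l + 1 ∧ ∀ a ∈ w.tail, (a : ℕ) + 1 < Δ)
    (q := IsBranchWord Δ l) (S := fun a => True)
    (by simp) (isBranchWord_nil Δ l) (by simp [IsBranchWord]))
    (r := treeRoot Δ (l + 1)) (r' := none) rfl b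
  have hpos := rootedSum_false_pos (branchTree Δ l) lam hlam ⟨[], isBranchWord_nil Δ l⟩
  rw [rootOccupation, occupation_eq_rootedSum, h1, h1, rootedSum_rootJoin_true,
    rootedSum_rootJoin_false, branchRatio]
  simp only [Fintype.card_subtype_true, Fintype.card_fin]
  change lam * rootedSum (branchTree Δ l) lam _ _ ^ _ / (lam * rootedSum (branchTree Δ l) lam _ _ ^ _
    + (rootedSum (branchTree Δ l) lam _ _ + rootedSum (branchTree Δ l) lam _ _) ^ _) = _
  generalize rootedSum (branchTree Δ l) lam _ true = A at *
  generalize rootedSum (branchTree Δ l) lam _ false = B at *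
  rw [one_add_div hpos.ne', div_pow, add_comm A B]
  have : B ^ Δ ≠ 0 := by positivity
  field_simp

/-! ### Limits of the root marginals -/

section Limits

variable {d : ℕ} {lam x y : ℝ}

theorem div_one_add_pow_anti (hlam : 0 < lam) {u v : ℝ} (hu : 0 ≤ u) (huv : u ≤ v) :
    lam / (1 + v) ^ d ≤ lam / (1 + u) ^ d := by
  gcongr

theorem IsTwoCycle.eq_left (h : IsTwoCycle d lam x y) : lam / (1 + y) ^ d = x := by
  have := h.pos
  rw [← h.left, mul_div_cancel_right₀ _ (by positivity)]

theorem IsTwoCycle.eq_right (h : IsTwoCycle d lam x y) : lam / (1 + x) ^ d = y := by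
  have := h.pos.trans h.lt
  rw [← h.right, mul_div_cancel_right₀ _ (by positivity)]

theorem IsTwoCycle.lam_pos (h : IsTwoCycle d lam x y) : 0 < lam := by
  have h1 := h.pos
  have h2 := h.lt
  rw [← h.left]
  have : 0 < x := by linarith
  positivity

/-- The iterates from `lam` of the tree recursion converge to the two-cycle. -/
theorem IsTwoCycle.tendsto_iterates (hd : 2 ≤ d) (h : IsTwoCycle d lam x y) {R : ℕ → ℝ}
    (h0 : R 0 = lam) (hR : ∀ l, R (l + 1) = lam / (1 + R l) ^ d) :
    Tendsto (fun l => R (2 * l)) atTop (𝓝 x) ∧ Tendsto (fun l => R (2 * l + 1)) atTop (𝓝 y) := by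
  have hlam := h.lam_pos
  have hy := h.pos
  have hpos : ∀ l, 0 < R l := by
    intro l
    induction l with
    | zero => rwa [h0]
    | succ l ih => rw [hR]; positivity
  have hle : ∀ l, R l ≤ lam := by
    rintro (_ | l)
    · exact h0.le
    · rw [hR]
      exact div_le_self hlam.le (one_le_pow₀ (by linarith [hpos l]))
  -- The recursion reverses order, so its square preserves it; since R 0 = λ bounds all iterates,
  -- the even ones decrease.
  have hanti : ∀ l, R (2 * (l + 1)) ≤ R (2 * l) := by
    intro l
    induction l with
    | zero => rw [mul_zero, h0]; exact hle _
    | succ l ih =>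
      have h1 : R (2 * l + 1) ≤ R (2 * (l + 1) + 1) := by
        rw [hR, hR]
        exact div_one_add_pow_anti hlam (hpos _).le ih
      rw [show 2 * (l + 1 + 1) = 2 * (l + 1) + 1 + 1 by ring, hR,
        show R (2 * (l + 1)) = lam / (1 + R (2 * l + 1)) ^ d from hR _]
      exact div_one_add_pow_anti hlam (hpos _).le h1
  have hlow : ∀ l, x ≤ R (2 * l) ∧ R (2 * l + 1) ≤ y := by
    have hstep : ∀ l, x ≤ R l → R (l + 1) ≤ y := by
      intro l hl
      rw [hR, ← h.eq_right]
      exact div_one_add_pow_anti hlam (hy.trans h.lt).le hl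
    intro l
    induction l with
    | zero =>
      have : x ≤ R (2 * 0) := by
        rw [mul_zero, h0, ← h.eq_left]
        exact div_le_self hlam.le (one_le_pow₀ (by linarith))
      exact ⟨this, hstep _ this⟩
    | succ l ih =>
      have : x ≤ R (2 * (l + 1)) := by
        rw [show 2 * (l + 1) = 2 * l + 1 + 1 by ring, hR, ← h.eq_left]
        exact div_one_add_pow_anti hlam (hpos _).le ih.2
      exact ⟨this, hstep _ this⟩
  have hbdd : BddBelow (Set.range fun l => R (2 * l)) :=
    ⟨x, by rintro _ ⟨l, rfl⟩; exact (hlow l).1⟩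
  have hq := tendsto_atTop_ciInf (antitone_nat_of_succ_le hanti) hbdd
  generalize (⨅ l, R (2 * l)) = q at hq
  have hqx : x ≤ q := ge_of_tendsto' hq fun l => (hlow l).1
  have hq0 : 0 < q := by linarith [h.lt]
  have hodd : Tendsto (fun l => R (2 * l + 1)) atTop (𝓝 (lam / (1 + q) ^ d)) := by
    simp only [hR]
    exact tendsto_const_nhds.div ((tendsto_const_nhds.add hq).pow d) (by positivity)
  have hq' : lam / (1 + q) ^ d ≤ y := le_of_tendsto' hodd fun l => (hlow l).2
  have hq'0 : 0 < lam / (1 + q) ^ d := by positivity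
  have heven : Tendsto (fun l => R (2 * (l + 1))) atTop
      (𝓝 (lam / (1 + lam / (1 + q) ^ d) ^ d)) := by
    have e : ∀ l, R (2 * (l + 1)) = lam / (1 + R (2 * l + 1)) ^ d := fun l => hR (2 * l + 1)
    simp only [e]
    exact tendsto_const_nhds.div ((tendsto_const_nhds.add hodd).pow d) (by positivity)
  have hfix := tendsto_nhds_unique heven (hq.comp (tendsto_add_atTop_nat 1))
  -- The even limit q is at least x and its image at most y < x, so the two are distinct and form a
  -- two-cycle. Uniqueness then gives q = x.
  have hcycle : IsTwoCycle d lam q (lam / (1 + q) ^ d) :=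
    ⟨hq'0, by linarith [h.lt], by
      nth_rw 1 [← hfix]
      exact div_mul_cancel₀ _ (by positivity), div_mul_cancel₀ _ (by positivity)⟩
  obtain ⟨e1, e2⟩ := h.unique hd hcycle
  rw [← e2] at hodd
  rw [← e1] at hq
  exact ⟨hq, hodd⟩

theorem IsTwoCycle.tendsto_rootOccupation (hd : 2 ≤ d) (h : IsTwoCycle d lam x y) :
    Tendsto (fun l : ℕ => rootOccupation (d + 1) lam (2 * l)) atTop (𝓝 (x / (1 + x + y))) ∧
    Tendsto (fun l : ℕ => rootOccupation (d + 1) lam (2 * l + 1)) atTop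
      (𝓝 (y / (1 + x + y))) := by
  have hlam := h.lam_pos
  have hy := h.pos
  have hx := hy.trans h.lt
  obtain ⟨h1, h2⟩ := h.tendsto_iterates hd (branchRatio_zero (d + 1) lam)
    (fun l => branchRatio_succ (by omega) hlam l)
  have key : ∀ {u v : ℝ}, 0 < u → 0 < v → u * (1 + v) ^ d = lam →
      lam / (lam + (1 + v) ^ (d + 1)) = u / (1 + u + v) := by
    intro u v hu hv huv
    rw [← huv]
    field_simp
    ring
  constructor
  -- The shift avoids depth 0, which `rootOccupation_succ` does not cover. An even tree has branches
  -- of odd depth, whose ratios tend to y.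
  · rw [← key hx hy h.left, ← tendsto_add_atTop_iff_nat 1]
    have e : ∀ l, rootOccupation (d + 1) lam (2 * (l + 1))
        = lam / (lam + (1 + branchRatio (d + 1) lam (2 * l + 1)) ^ (d + 1)) :=
      fun l => rootOccupation_succ _ hlam (2 * l + 1)
    simp only [e]
    exact tendsto_const_nhds.div
      (tendsto_const_nhds.add ((tendsto_const_nhds.add h2).pow _)) (by positivity)
  · rw [show 1 + x + y = 1 + y + x by ring, ← key hy hx h.right]
    simp only [rootOccupation_succ _ hlam]
    exact tendsto_const_nhds.div
      (tendsto_const_nhds.add ((tendsto_const_nhds.add h1).pow _)) (by positivity)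

end Limits

/-! ### The first moment exponent -/

open Real (negMulLog)

/-- The exponent of the first moment of the number of independent sets with densities `a`, `b`
on the two sides of a random bipartite regular graph of degree `d + 1`. -/
noncomputable def Phi₁ (d : ℕ) (lam : ℝ) (p : ℝ × ℝ) : ℝ :=
  (p.1 + p.2) * Real.log lam + negMulLog p.1 + negMulLog p.2
    + (d + 1) * negMulLog (1 - p.1 - p.2)
    - d * (negMulLog (1 - p.1) + negMulLog (1 - p.2))

/-- The densities for which `Phi₁` is considered. -/
def densities : Set (ℝ × ℝ) := {p | 0 ≤ p.1 ∧ 0 ≤ p.2 ∧ p.1 + p.2 ≤ 1}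

theorem isCompact_densities : IsCompact densities := by
  refine (isCompact_Icc (a := ((0 : ℝ), (0 : ℝ))) (b := (1, 1))).of_isClosed_subset ?_ ?_
  · exact (isClosed_le continuous_const continuous_fst).inter
      ((isClosed_le continuous_const continuous_snd).inter
        (isClosed_le (continuous_fst.add continuous_snd) continuous_const))
  · rintro ⟨a, b⟩ ⟨h1, h2, h3⟩
    simp only at h1 h2 h3
    exact ⟨⟨h1, h2⟩, ⟨by simp only; linarith, by simp only; linarith⟩⟩

theorem continuous_Phi₁ (d : ℕ) (lam : ℝ) : Continuous (Phi₁ d lam) := by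
  have := Real.continuous_negMulLog
  unfold Phi₁
  fun_prop

theorem Phi₁_swap (d : ℕ) (lam : ℝ) (p : ℝ × ℝ) : Phi₁ d lam p.swap = Phi₁ d lam p := by
  simp only [Phi₁, Prod.fst_swap, Prod.snd_swap]
  rw [sub_right_comm 1 p.2 p.1]
  ring

/-- A maximizer of `Phi₁`. -/
def IsMaximizer (d : ℕ) (lam : ℝ) (p : ℝ × ℝ) : Prop :=
  p ∈ densities ∧ ∀ q ∈ densities, Phi₁ d lam q ≤ Phi₁ d lam p

theorem exists_isMaximizer (d : ℕ) (lam : ℝ) : ∃ p, IsMaximizer d lam p := by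
  obtain ⟨p, hp, h⟩ := isCompact_densities.exists_isMaxOn
    ⟨(0, 0), by simp [densities]⟩ (continuous_Phi₁ d lam).continuousOn
  exact ⟨p, hp, h⟩

/-! ### Maximizers lie in the interior -/

section Boundary

theorem differentiableAt_negMulLog_comp {f : ℝ → ℝ} {t : ℝ} (hf : DifferentiableAt ℝ f t)
    (h : f t ≠ 0) : DifferentiableAt ℝ (fun s => negMulLog (f s)) t :=
  ((Real.hasDerivAt_negMulLog h).differentiableAt).comp t hf

/-- The infinite slope of `negMulLog` at `0` beats every differentiable function. -/
theorem exists_lt_add_negMulLog {h : ℝ → ℝ} (hh : DifferentiableAt ℝ h 0) {c δ : ℝ} (hc : 0 < c)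
    (hδ : 0 < δ) : ∃ t, 0 < t ∧ t < δ ∧ h 0 < h t + c * negMulLog t := by
  have h1 := (hasDerivAt_iff_tendsto_slope_zero.1 hh.hasDerivAt).mono_left
    (nhdsWithin_mono 0 (fun t (ht : t ∈ Set.Ioi (0 : ℝ)) => ne_of_gt ht))
  have h2 : ∀ᶠ t in 𝓝[>] (0 : ℝ), deriv h 0 - 1 < t⁻¹ • (h (0 + t) - h 0) :=
    h1.eventually_const_lt (sub_one_lt _)
  have h3 := Real.tendsto_log_nhdsGT_zero.eventually_lt_atBot ((deriv h 0 - 1) / c)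
  have h4 : ∀ᶠ t in 𝓝[>] (0 : ℝ), t < δ := nhdsWithin_le_nhds (eventually_lt_nhds hδ)
  have h5 : ∀ᶠ t in 𝓝[>] (0 : ℝ), 0 < t := eventually_mem_nhdsWithin
  obtain ⟨t, h2, h3, h4, h5⟩ := (h2.and (h3.and (h4.and h5))).exists
  refine ⟨t, h5, h4, ?_⟩
  rw [zero_add, smul_eq_mul, inv_mul_eq_div, lt_div_iff₀ h5] at h2
  rw [lt_div_iff₀ hc] at h3
  have h6 := mul_lt_mul_of_pos_right h3 h5
  rw [negMulLog]
  nlinarith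

variable {d : ℕ} {lam : ℝ} {p : ℝ × ℝ}

theorem IsMaximizer.swap (h : IsMaximizer d lam p) : IsMaximizer d lam p.swap := by
  refine ⟨⟨h.1.2.1, h.1.1, by rw [add_comm]; exact h.1.2.2⟩, fun q hq => ?_⟩
  rw [Phi₁_swap]
  exact h.2 q hq

/-- On the edge a + b = 1, lowering a by t creates (d+1) `negMulLog t`, whose infinite slope wins.
At the corner (1,0) the term with `1 - a` is singular too and takes back d of these, but one
remains. -/
theorem IsMaximizer.add_lt_one_of_pos (h : IsMaximizer d lam p) (hp : 0 < p.1) :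
    p.1 + p.2 < 1 := by
  obtain ⟨a, b⟩ := p
  obtain ⟨⟨h1, h2, h3⟩, hmax⟩ := h
  simp only at *
  by_contra hc
  obtain rfl : b = 1 - a := by linarith
  rcases h2.eq_or_lt with hb | hb
  · obtain rfl : a = 1 := by linarith
    have hd : DifferentiableAt ℝ
        (fun t => (1 - t) * Real.log lam + negMulLog (1 - t)) (0 : ℝ) :=
      (by fun_prop : DifferentiableAt ℝ (fun t => (1 - t) * Real.log lam) (0 : ℝ)).add
        (differentiableAt_negMulLog_comp (by fun_prop) (by norm_num))
    obtain ⟨t, ht0, ht1, ht⟩ := exists_lt_add_negMulLog hd one_pos one_pos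
    have := hmax (1 - t, 0) ⟨by simp only; linarith, le_rfl, by simp only; linarith⟩
    have e : 1 - (1 - t) = t := by ring
    simp [Phi₁, e] at this ht
    linarith
  · have hd : DifferentiableAt ℝ (fun t => (a - t + (1 - a)) * Real.log lam + negMulLog (a - t)
        + negMulLog (1 - a) - d * (negMulLog (1 - a + t) + negMulLog (1 - (1 - a)))) (0 : ℝ) := by
      have e1 : DifferentiableAt ℝ (fun t => negMulLog (a - t)) (0 : ℝ) :=
        differentiableAt_negMulLog_comp (by fun_prop) (by simpa using hp.ne')
      have e2 : DifferentiableAt ℝ (fun t => negMulLog (1 - a + t)) (0 : ℝ) :=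
        differentiableAt_negMulLog_comp (by fun_prop) (by simpa using hb.ne')
      fun_prop
    obtain ⟨t, ht0, ht1, ht⟩ := exists_lt_add_negMulLog hd (by positivity : (0 : ℝ) < d + 1) hp
    have := hmax (a - t, 1 - a) ⟨by simp only; linarith, hb.le, by simp only; linarith⟩
    have e : 1 - a + t - (1 - a) = t := by ring
    have e' : 1 - (a - t) = 1 - a + t := by ring
    simp only [Phi₁, e', e, sub_zero, add_zero, sub_self, Real.negMulLog_zero, mul_zero] at this ht
    linarith

theorem IsMaximizer.add_lt_one (h : IsMaximizer d lam p) : p.1 + p.2 < 1 := by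
  rcases h.1.1.eq_or_lt with h1 | h1
  · rcases h.1.2.1.eq_or_lt with h2 | h2
    · rw [← h1, ← h2]; norm_num
    · have := h.swap.add_lt_one_of_pos h2
      simpa [add_comm] using this
  · exact h.add_lt_one_of_pos h1

/-- At a = 0 only `negMulLog a` is singular, since b < 1 by `add_lt_one`; its infinite slope makes a
small positive a better. -/
theorem IsMaximizer.fst_pos (h : IsMaximizer d lam p) : 0 < p.1 := by
  have hlt := h.add_lt_one
  obtain ⟨a, b⟩ := p
  obtain ⟨⟨h1, h2, h3⟩, hmax⟩ := h
  simp only at *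
  by_contra hc
  obtain rfl : a = 0 := by linarith
  have hb : 1 - b ≠ 0 := by linarith
  have hd : DifferentiableAt ℝ (fun t => (t + b) * Real.log lam + negMulLog b
      + (d + 1) * negMulLog (1 - t - b) - d * (negMulLog (1 - t) + negMulLog (1 - b))) (0 : ℝ) := by
    have e1 : DifferentiableAt ℝ (fun t => negMulLog (1 - t - b)) (0 : ℝ) :=
      differentiableAt_negMulLog_comp (by fun_prop) (by simpa using hb)
    have e2 : DifferentiableAt ℝ (fun t => negMulLog (1 - t)) (0 : ℝ) :=
      differentiableAt_negMulLog_comp (by fun_prop) (by norm_num)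
    fun_prop
  obtain ⟨t, ht0, ht1, ht⟩ := exists_lt_add_negMulLog hd one_pos (by linarith : 0 < 1 - b)
  have := hmax (t, b) ⟨ht0.le, h2, by simp only; linarith⟩
  simp only [Phi₁, Real.negMulLog_zero] at this ht
  linarith

theorem IsMaximizer.snd_pos (h : IsMaximizer d lam p) : 0 < p.2 := h.swap.fst_pos

end Boundary

/-! ### Critical points of the first moment exponent -/

/-- The derivative of `Phi₁` with respect to its first argument. -/
noncomputable def slope₁ (d : ℕ) (lam a b : ℝ) : ℝ :=
  Real.log lam - Real.log a + (d + 1) * Real.log (1 - a - b) - d * Real.log (1 - a)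

section Calculus

variable {d : ℕ} {lam : ℝ}

theorem hasDerivAt_negMulLog_comp {f : ℝ → ℝ} {f' t : ℝ} (hf : HasDerivAt f f' t)
    (h : f t ≠ 0) :
    HasDerivAt (fun s => negMulLog (f s)) ((-Real.log (f t) - 1) * f') t :=
  (Real.hasDerivAt_negMulLog h).comp t hf

theorem hasDerivAt_line (a u t : ℝ) : HasDerivAt (fun t => a + t * u) u t := by
  simpa using ((hasDerivAt_id' t).mul_const u).const_add a

theorem hasDerivAt_Phi₁_line {a b u v t : ℝ} (ha : 0 < a + t * u) (hb : 0 < b + t * v)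
    (hab : (a + t * u) + (b + t * v) < 1) :
    HasDerivAt (fun t => Phi₁ d lam (a + t * u, b + t * v))
      (u * slope₁ d lam (a + t * u) (b + t * v) + v * slope₁ d lam (b + t * v) (a + t * u)) t := by
  have ea := hasDerivAt_line a u t
  have eb := hasDerivAt_line b v t
  have h1 := (ea.add eb).mul_const (Real.log lam)
  have h2 := hasDerivAt_negMulLog_comp ea ha.ne'
  have h3 := hasDerivAt_negMulLog_comp eb hb.ne'
  have h4 := (hasDerivAt_negMulLog_comp ((ea.const_sub 1).sub eb)
    (by simp only [Pi.sub_apply]; linarith)).const_mul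
    ((d : ℝ) + 1)
  have h5 := hasDerivAt_negMulLog_comp (ea.const_sub 1) (by linarith)
  have h6 := hasDerivAt_negMulLog_comp (eb.const_sub 1) (by linarith)
  refine ((((h1.add h2).add h3).add h4).sub ((h5.add h6).const_mul (d : ℝ))).congr_deriv ?_
  simp only [slope₁, Pi.sub_apply]
  rw [sub_right_comm 1 (b + t * v)]
  ring

theorem hasDerivAt_slope₁_line {a b u v t : ℝ} (ha : 0 < a + t * u) (hb : 0 < b + t * v)
    (hab : (a + t * u) + (b + t * v) < 1) :
    HasDerivAt (fun t => slope₁ d lam (a + t * u) (b + t * v))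
      (-(u / (a + t * u)) - (d + 1) * ((u + v) / (1 - (a + t * u) - (b + t * v)))
        + d * (u / (1 - (a + t * u)))) t := by
  have ea := hasDerivAt_line a u t
  have eb := hasDerivAt_line b v t
  have h2 := ea.log ha.ne'
  have h4 := (((ea.const_sub 1).sub eb).log
    (by simp only [Pi.sub_apply]; linarith)).const_mul ((d : ℝ) + 1)
  have h5 := ((ea.const_sub 1).log (by linarith)).const_mul (d : ℝ)
  refine (((h2.const_sub (Real.log lam)).add h4).sub h5).congr_deriv ?_
  simp only [Pi.sub_apply]
  ring

/-- The second derivative of `Phi₁` at `(a, b)` in the direction `(u, v)`. -/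
noncomputable def hessian₁ (d : ℕ) (a b u v : ℝ) : ℝ :=
  u ^ 2 * (d / (1 - a) - 1 / a) + v ^ 2 * (d / (1 - b) - 1 / b)
    - (d + 1) * (u + v) ^ 2 / (1 - a - b)

theorem hasDerivAt_Phi₁_line_deriv {a b u v t : ℝ} (ha : 0 < a + t * u) (hb : 0 < b + t * v)
    (hab : (a + t * u) + (b + t * v) < 1) :
    HasDerivAt (fun t => u * slope₁ d lam (a + t * u) (b + t * v)
        + v * slope₁ d lam (b + t * v) (a + t * u))
      (hessian₁ d (a + t * u) (b + t * v) u v) t := by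
  refine (((hasDerivAt_slope₁_line ha hb hab).const_mul u).add
    ((hasDerivAt_slope₁_line hb ha (by linarith)).const_mul v)).congr_deriv ?_
  rw [hessian₁, sub_right_comm 1 (b + t * v)]
  ring

/-- The mean value theorem is applied twice: to g, giving a slope at some c, and to g' on [0, c]. -/
theorem lt_tangent_of_deriv2_neg {g g' g'' : ℝ → ℝ}
    (h1 : ∀ t ∈ Set.Icc (0 : ℝ) 1, HasDerivAt g (g' t) t)
    (h2 : ∀ t ∈ Set.Icc (0 : ℝ) 1, HasDerivAt g' (g'' t) t)
    (h3 : ∀ t ∈ Set.Icc (0 : ℝ) 1, g'' t < 0) : g 1 < g 0 + g' 0 := by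
  obtain ⟨c, hc, e⟩ := exists_hasDerivAt_eq_slope g g' one_pos
    (fun t ht => (h1 t ht).continuousAt.continuousWithinAt) fun t ht => h1 t ⟨ht.1.le, ht.2.le⟩
  obtain ⟨c', hc', e'⟩ := exists_hasDerivAt_eq_slope g' g'' hc.1
    (fun t ht => (h2 t ⟨ht.1, ht.2.trans hc.2.le⟩).continuousAt.continuousWithinAt)
    fun t ht => h2 t ⟨ht.1.le, (ht.2.trans hc.2).le⟩
  have h := h3 c' ⟨hc'.1.le, (hc'.2.trans hc.2).le⟩
  rw [e', sub_zero, div_lt_iff₀ hc.1, zero_mul] at h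
  simp at e
  linarith

/-- The second derivative is not positive at a local maximum. -/
theorem deriv2_nonpos_of_isLocalMax {g g' : ℝ → ℝ} {g'' x : ℝ} (h : IsLocalMax g x)
    (h1 : ∀ᶠ t in 𝓝 x, HasDerivAt g (g' t) t) (h2 : HasDerivAt g' g'' x) : g'' ≤ 0 := by
  by_contra! hc
  -- A positive second derivative would make x a local minimum as well, so g would be locally
  -- constant and its second derivative zero.
  have e : deriv g =ᶠ[𝓝 x] g' := h1.mono fun t ht => ht.deriv
  have e2 : deriv (deriv g) x = g'' := by rw [e.deriv_eq, h2.deriv]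
  have hmin := isLocalMin_of_deriv_deriv_pos (by rw [e2]; exact hc)
    (h.deriv_eq_zero) h1.self_of_nhds.continuousAt
  have hconst : g =ᶠ[𝓝 x] fun _ => g x := by
    filter_upwards [h, hmin] with t ht ht' using le_antisymm ht ht'
  have hd : deriv g =ᶠ[𝓝 x] fun _ => 0 := by
    have := hconst.deriv
    simpa using this
  have := hd.deriv_eq
  rw [e2] at this
  simp at this
  linarith

end Calculus

/-! ### Maximizers and two-cycles -/

section Maximizers

variable {d : ℕ} {lam : ℝ} {p : ℝ × ℝ}

theorem IsMaximizer.isLocalMax_line (h : IsMaximizer d lam p) (u v : ℝ) :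
    IsLocalMax (fun t => Phi₁ d lam (p.1 + t * u, p.2 + t * v)) 0 ∧
    ∀ᶠ t in 𝓝 (0 : ℝ), 0 < p.1 + t * u ∧ 0 < p.2 + t * v ∧
      (p.1 + t * u) + (p.2 + t * v) < 1 := by
  have hev : ∀ᶠ t in 𝓝 (0 : ℝ), 0 < p.1 + t * u ∧ 0 < p.2 + t * v ∧
      (p.1 + t * u) + (p.2 + t * v) < 1 := by
    have c1 : Continuous fun t : ℝ => p.1 + t * u := by fun_prop
    have c2 : Continuous fun t : ℝ => p.2 + t * v := by fun_prop
    have h1 := (c1.tendsto 0).eventually_const_lt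
      (show 0 < p.1 + 0 * u by simpa using h.fst_pos)
    have h2 := (c2.tendsto 0).eventually_const_lt
      (show 0 < p.2 + 0 * v by simpa using h.snd_pos)
    have h3 := ((c1.add c2).tendsto 0).eventually_lt_const
      (show p.1 + 0 * u + (p.2 + 0 * v) < 1 by simpa using h.add_lt_one)
    exact h1.and (h2.and h3)
  refine ⟨?_, hev⟩
  filter_upwards [hev] with t ht
  simp only [zero_mul, add_zero]
  exact h.2 _ ⟨ht.1.le, ht.2.1.le, ht.2.2.le⟩

theorem IsMaximizer.slope₁_eq_zero (h : IsMaximizer d lam p) : slope₁ d lam p.1 p.2 = 0 := by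
  obtain ⟨hmax, hev⟩ := h.isLocalMax_line 1 0
  obtain ⟨h1, h2, h3⟩ := hev.self_of_nhds
  have := hmax.hasDerivAt_eq_zero (hasDerivAt_Phi₁_line h1 h2 h3)
  simpa using this

/-- This is the exponential of the critical point equation: the densities divided by 1 - a - b
satisfy the tree recursion. -/
theorem IsMaximizer.activity_eq (hlam : 0 < lam) (h : IsMaximizer d lam p) :
    p.1 / (1 - p.1 - p.2) * (1 + p.2 / (1 - p.1 - p.2)) ^ d = lam := by
  have hs := h.slope₁_eq_zero
  have h1 := h.fst_pos
  have h2 := h.snd_pos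
  have h3 := h.add_lt_one
  have hw : 0 < 1 - p.1 - p.2 := by linarith
  have ha : 0 < 1 - p.1 := by linarith
  have e : 1 + p.2 / (1 - p.1 - p.2) = (1 - p.1) / (1 - p.1 - p.2) := by
    field_simp
    ring
  apply Real.log_injOn_pos (Set.mem_Ioi.2 (by positivity)) (Set.mem_Ioi.2 hlam)
  rw [e, Real.log_mul (by positivity) (by positivity), Real.log_pow,
    Real.log_div h1.ne' hw.ne', Real.log_div ha.ne' hw.ne']
  rw [slope₁] at hs
  linarith

/-- Above the critical activity, no maximizer is symmetric. -/
theorem IsMaximizer.fst_ne_snd (hd : 2 ≤ d) (hlam : lambdaC (d + 1) < lam)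
    (h : IsMaximizer d lam p) : p.1 ≠ p.2 := by
  intro heq
  obtain ⟨a, b⟩ := p
  obtain rfl : a = b := heq
  have h1 : 0 < a := h.fst_pos
  have h3 : a + a < 1 := h.add_lt_one
  have hd' : (2 : ℝ) ≤ d := by exact_mod_cast hd
  have hl0 : 0 < lam := by
    refine lt_of_le_of_lt ?_ hlam
    rw [lambdaC]
    push_cast
    exact div_nonneg (pow_nonneg (by linarith) _) (pow_nonneg (by linarith) _)
  -- In this direction a + b is constant, and the second derivative test reads (d+1)a ≤ 1. Hence x =
  -- a/(1-2a) ≤ 1/(d-1), the point where x(1+x)^d equals λ_c.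
  obtain ⟨hmax, hev⟩ := h.isLocalMax_line 1 (-1)
  obtain ⟨e1, e2, e3⟩ := hev.self_of_nhds
  have hH := deriv2_nonpos_of_isLocalMax hmax
    (hev.mono fun t ht => hasDerivAt_Phi₁_line ht.1 ht.2.1 ht.2.2)
    (hasDerivAt_Phi₁_line_deriv e1 e2 e3)
  have hact : a / (1 - a - a) * (1 + a / (1 - a - a)) ^ d = lam := h.activity_eq hl0
  have ha : 0 < 1 - a := by linarith
  simp only [hessian₁] at hH
  norm_num at hH
  rw [← one_div, div_le_div_iff₀ ha h1] at hH
  have hw : 0 < 1 - a - a := by linarith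
  have hx : a / (1 - a - a) ≤ 1 / (d - 1) := by
    rw [div_le_div_iff₀ hw (by linarith)]
    linarith
  have hx0 : 0 ≤ a / (1 - a - a) := by positivity
  have e : lambdaC (d + 1) = 1 / (d - 1) * (1 + 1 / ((d : ℝ) - 1)) ^ d := by
    have h5 : (d : ℝ) - 1 ≠ 0 := by linarith
    rw [lambdaC, one_add_div h5, div_pow]
    push_cast
    rw [show (d : ℝ) + 1 - 1 = d by ring, show (d : ℝ) - 1 + 1 = d by ring,
      show (d : ℝ) + 1 - 2 = d - 1 by ring]
    field_simp
    ring
  have : lam ≤ lambdaC (d + 1) := by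
    have : 0 ≤ 1 / ((d : ℝ) - 1) := hx0.trans hx
    rw [← hact, e]
    gcongr
  linarith

/-- The densities that belong to a two-cycle. -/
noncomputable def cycleDensities (x y : ℝ) : ℝ × ℝ := (x / (1 + x + y), y / (1 + x + y))

/-- Above the critical activity there is a two-cycle, and its densities, in either order, are
the maximizers of `Phi₁`. -/
theorem exists_isTwoCycle_isMaximizer (hd : 2 ≤ d) (hlam0 : 0 < lam)
    (hlam : lambdaC (d + 1) < lam) :
    ∃ x y, IsTwoCycle d lam x y ∧ IsMaximizer d lam (cycleDensities x y) ∧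
      ∀ p, IsMaximizer d lam p → p = cycleDensities x y ∨ p = (cycleDensities x y).swap := by
  have key : ∀ p, IsMaximizer d lam p → p.2 < p.1 → ∃ x y, IsTwoCycle d lam x y ∧
      p = cycleDensities x y := by
    intro p h hlt
    have h1 := h.fst_pos
    have h2 := h.snd_pos
    have h3 := h.add_lt_one
    have hw : 0 < 1 - p.1 - p.2 := by linarith
    have e2 := h.swap.activity_eq hlam0
    simp only [Prod.fst_swap, Prod.snd_swap] at e2
    rw [sub_right_comm] at e2
    refine ⟨p.1 / (1 - p.1 - p.2), p.2 / (1 - p.1 - p.2), ⟨by positivity, ?_,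
      h.activity_eq hlam0, e2⟩, ?_⟩
    · gcongr
    · have e : 1 + p.1 / (1 - p.1 - p.2) + p.2 / (1 - p.1 - p.2) = 1 / (1 - p.1 - p.2) := by
        field_simp
        ring
      ext
      · simp only [cycleDensities, e]
        field_simp
      · simp only [cycleDensities, e]
        field_simp
  obtain ⟨p, hp, hlt⟩ : ∃ p, IsMaximizer d lam p ∧ p.2 < p.1 := by
    obtain ⟨p, hp⟩ := exists_isMaximizer d lam
    rcases lt_or_gt_of_ne (hp.fst_ne_snd hd hlam) with h | h
    · exact ⟨p.swap, hp.swap, h⟩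
    · exact ⟨p, hp, h⟩
  obtain ⟨x, y, hxy, rfl⟩ := key p hp hlt
  have huniq : ∀ q, IsMaximizer d lam q → q.2 < q.1 → q = cycleDensities x y := by
    intro q hq hlt'
    obtain ⟨x', y', h', rfl⟩ := key q hq hlt'
    obtain ⟨rfl, rfl⟩ := hxy.unique hd h'
    rfl
  refine ⟨x, y, hxy, hp, fun q hq => ?_⟩
  rcases lt_or_gt_of_ne (hq.fst_ne_snd hd hlam) with h | h
  · right
    rw [← huniq q.swap hq.swap h, Prod.swap_swap]
  · exact Or.inl (huniq q hq h)

end Maximizers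

/-! ### Strict concavity near the two-cycle densities -/

section Concavity

variable {d : ℕ} {lam : ℝ}

/-- `Phi₁` has a negative definite second derivative in the interior point `p`. -/
def IsConcaveAt (d : ℕ) (p : ℝ × ℝ) : Prop :=
  0 < p.1 ∧ 0 < p.2 ∧ 0 < 1 - p.1 - p.2 ∧
    0 < 1 / p.1 - d / (1 - p.1) + (d + 1) / (1 - p.1 - p.2) ∧
    ((d + 1) / (1 - p.1 - p.2)) ^ 2 < (1 / p.1 - d / (1 - p.1) + (d + 1) / (1 - p.1 - p.2))
      * (1 / p.2 - d / (1 - p.2) + (d + 1) / (1 - p.1 - p.2))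

theorem IsConcaveAt.hessian₁_neg {p : ℝ × ℝ} (h : IsConcaveAt d p) {u v : ℝ}
    (huv : u ≠ 0 ∨ v ≠ 0) : hessian₁ d p.1 p.2 u v < 0 := by
  obtain ⟨-, -, -, hA, hdet⟩ := h
  have e : hessian₁ d p.1 p.2 u v
      = -((1 / p.1 - d / (1 - p.1) + (d + 1) / (1 - p.1 - p.2)) * u ^ 2
        + 2 * ((d + 1) / (1 - p.1 - p.2)) * (u * v)
        + (1 / p.2 - d / (1 - p.2) + (d + 1) / (1 - p.1 - p.2)) * v ^ 2) := by
    rw [hessian₁]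
    ring
  rw [e]
  generalize 1 / p.1 - d / (1 - p.1) + (d + 1) / (1 - p.1 - p.2) = A at *
  generalize 1 / p.2 - d / (1 - p.2) + (d + 1) / (1 - p.1 - p.2) = C at *
  generalize (d + 1) / (1 - p.1 - p.2) = B at *
  rw [neg_lt_zero]
  refine pos_of_mul_pos_right ?_ hA.le
  have e2 : A * (A * u ^ 2 + 2 * B * (u * v) + C * v ^ 2)
      = (A * u + B * v) ^ 2 + (A * C - B ^ 2) * v ^ 2 := by ring
  rw [e2]
  have h2 : 0 < A * C - B ^ 2 := by linarith
  by_cases hv : v = 0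
  · subst hv
    have hu : u ≠ 0 := by simpa using huv
    have : A * u ≠ 0 := mul_ne_zero hA.ne' hu
    simp only [mul_zero, add_zero]
    positivity
  · positivity

/-- The determinant is a positive multiple of 1 + x + y - (d²-1)xy, so its sign is the stability of
the cycle; the diagonal entry is visibly positive. -/
theorem IsTwoCycle.isConcaveAt {x y : ℝ} (hd : 2 ≤ d) (h : IsTwoCycle d lam x y) :
    IsConcaveAt d (cycleDensities x y) := by
  have hs := h.stable hd
  have hy := h.pos
  have hx := hy.trans h.lt
  have e1 : 1 - x / (1 + x + y) = (1 + y) / (1 + x + y) := by field_simp; ring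
  have e2 : 1 - y / (1 + x + y) = (1 + x) / (1 + x + y) := by field_simp; ring
  have e3 : 1 - x / (1 + x + y) - y / (1 + x + y) = 1 / (1 + x + y) := by field_simp; ring
  refine ⟨by simp only [cycleDensities]; positivity, by simp only [cycleDensities]; positivity,
    by simp only [cycleDensities]; rw [e3]; positivity, ?_, ?_⟩
  · simp only [cycleDensities]
    rw [e3, e1]
    have e : 1 / (x / (1 + x + y)) - d / ((1 + y) / (1 + x + y)) + (d + 1) / (1 / (1 + x + y))
        = (1 + x + y) * (1 / x + 1 + d * y / (1 + y)) := by
      field_simp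
      ring
    rw [e]
    positivity
  · simp only [cycleDensities]
    rw [e3, e1, e2, ← sub_pos]
    have e : (1 / (x / (1 + x + y)) - d / ((1 + y) / (1 + x + y)) + (d + 1) / (1 / (1 + x + y)))
        * (1 / (y / (1 + x + y)) - d / ((1 + x) / (1 + x + y)) + (d + 1) / (1 / (1 + x + y)))
        - (((d : ℝ) + 1) / (1 / (1 + x + y))) ^ 2
        = (1 + x + y) ^ 3 * (1 + x + y - ((d : ℝ) ^ 2 - 1) * (x * y))
          / (x * y * (1 + x) * (1 + y)) := by
      field_simp
      ring
    rw [e]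
    have : 0 < 1 + x + y - ((d : ℝ) ^ 2 - 1) * (x * y) := by linarith
    positivity

theorem IsConcaveAt.exists_ball {p : ℝ × ℝ} (h : IsConcaveAt d p) :
    ∃ r > 0, ∀ q ∈ Metric.ball p r, IsConcaveAt d q := by
  obtain ⟨h1, h2, h3, h4, h5⟩ := h
  rw [← Metric.eventually_nhds_iff_ball]
  have n1 : 1 - p.1 ≠ 0 := by linarith
  have n2 : 1 - p.2 ≠ 0 := by linarith
  have n3 := h3.ne'
  have n4 := h1.ne'
  have n5 := h2.ne'
  have c1 : ContinuousAt (fun q : ℝ × ℝ => 1 / q.1 - d / (1 - q.1) + (d + 1) / (1 - q.1 - q.2)) p :=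
    by fun_prop (disch := assumption)
  have c2 : ContinuousAt (fun q : ℝ × ℝ => 1 / q.2 - d / (1 - q.2) + (d + 1) / (1 - q.1 - q.2)) p :=
    by fun_prop (disch := assumption)
  have c3 : ContinuousAt (fun q : ℝ × ℝ => (((d : ℝ) + 1) / (1 - q.1 - q.2)) ^ 2) p := by
    fun_prop (disch := assumption)
  have c4 : ContinuousAt (fun q : ℝ × ℝ => 1 - q.1 - q.2) p := by fun_prop
  exact (continuousAt_fst.eventually_const_lt h1).and <|
    (continuousAt_snd.eventually_const_lt h2).and <|
    (c4.eventually_const_lt h3).and <| (c1.eventually_const_lt h4).and <|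
    c3.eventually_lt (c1.mul c2) h5

theorem Phi₁_lt_tangent {p q c : ℝ × ℝ} {r : ℝ} (h : ∀ q ∈ Metric.ball c r, IsConcaveAt d q)
    (hp : p ∈ Metric.ball c r) (hq : q ∈ Metric.ball c r) (hpq : q ≠ p) :
    Phi₁ d lam q < Phi₁ d lam p
      + ((q.1 - p.1) * slope₁ d lam p.1 p.2 + (q.2 - p.2) * slope₁ d lam p.2 p.1) := by
  have hline : ∀ t ∈ Set.Icc (0 : ℝ) 1,
      IsConcaveAt d (p.1 + t * (q.1 - p.1), p.2 + t * (q.2 - p.2)) := fun t ht =>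
    h _ ((convex_ball c r).add_smul_sub_mem hp hq ht)
  have hne : q.1 - p.1 ≠ 0 ∨ q.2 - p.2 ≠ 0 := by
    by_contra! hc
    exact hpq (Prod.ext (by linarith [hc.1]) (by linarith [hc.2]))
  have := lt_tangent_of_deriv2_neg
    (fun t ht => hasDerivAt_Phi₁_line (d := d) (lam := lam) (hline t ht).1 (hline t ht).2.1
      (by linarith [(hline t ht).2.2.1]))
    (fun t ht => hasDerivAt_Phi₁_line_deriv (hline t ht).1 (hline t ht).2.1
      (by linarith [(hline t ht).2.2.1]))
    (fun t ht => (hline t ht).hessian₁_neg hne)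
  simpa using this

end Concavity

/-- Densities close to a maximizer `c` with negative definite second derivative are not, on
average, improved by splitting them into three with weights `a`, `b` and `1 - a - b`. -/
theorem exists_strict_jensen {d : ℕ} {lam : ℝ} {c : ℝ × ℝ} (hc : IsMaximizer d lam c)
    (hlt : c.2 < c.1) (hconc : IsConcaveAt d c)
    (hmax : ∀ p, IsMaximizer d lam p → p = c ∨ p = c.swap) :
    ∃ χ > 0, ∀ p ∈ Metric.ball c χ, 0 < p.1 ∧ 0 < p.2 ∧ 0 < 1 - p.1 - p.2 ∧
      ∀ q₁ ∈ densities, ∀ q₂ ∈ densities, ∀ q₃ ∈ densities,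
        p.1 • q₁ + p.2 • q₂ + (1 - p.1 - p.2) • q₃ = p →
        ¬(q₁ = p ∧ q₂ = p ∧ q₃ = p) →
        p.1 * Phi₁ d lam q₁ + p.2 * Phi₁ d lam q₂ + (1 - p.1 - p.2) * Phi₁ d lam q₃
          < Phi₁ d lam p := by
  obtain ⟨r, hr, hball⟩ := hconc.exists_ball
  -- Counterexamples with p → c are taken, and compactness gives limits z₁, z₂, z₃ of the
  -- splittings. By continuity the limits have mean c and average value at least the maximum, so
  -- each is a maximizer.
  by_contra! hcon
  have hpos : ∀ n : ℕ, (0 : ℝ) < min r (1 / ((n : ℝ) + 1)) := fun n =>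
    lt_min hr Nat.one_div_pos_of_nat
  have hseq : ∀ n : ℕ, ∃ p ∈ Metric.ball c (min r (1 / ((n : ℝ) + 1))),
      ∃ q₁ ∈ densities, ∃ q₂ ∈ densities, ∃ q₃ ∈ densities,
        p.1 • q₁ + p.2 • q₂ + (1 - p.1 - p.2) • q₃ = p ∧ ¬(q₁ = p ∧ q₂ = p ∧ q₃ = p) ∧
        Phi₁ d lam p ≤
          p.1 * Phi₁ d lam q₁ + p.2 * Phi₁ d lam q₂ + (1 - p.1 - p.2) * Phi₁ d lam q₃ := by
    intro n
    obtain ⟨p, hp, h⟩ := hcon _ (hpos n)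
    have hp' := hball p (Metric.ball_subset_ball (min_le_left _ _) hp)
    obtain ⟨q₁, h1, q₂, h2, q₃, h3, e, hne, hle⟩ := h hp'.1 hp'.2.1 hp'.2.2.1
    exact ⟨p, hp, q₁, h1, q₂, h2, q₃, h3, e, fun hh => hne hh.1 hh.2.1 hh.2.2, hle⟩
  choose p hp q₁ h1 q₂ h2 q₃ h3 e hne hle using hseq
  have hpc : Tendsto p atTop (𝓝 c) := by
    rw [tendsto_iff_dist_tendsto_zero]
    refine squeeze_zero (fun _ => dist_nonneg) (fun n => ?_)
      tendsto_one_div_add_atTop_nhds_zero_nat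
    exact (Metric.mem_ball.1 (hp n)).le.trans (min_le_right _ _)
  obtain ⟨⟨z₁, z₂, z₃⟩, hm, φ, hφ, hz⟩ :=
    (isCompact_densities.prod (isCompact_densities.prod isCompact_densities)).tendsto_subseq
      (x := fun n => (q₁ n, q₂ n, q₃ n)) fun n => ⟨h1 n, h2 n, h3 n⟩
  have m1 : z₁ ∈ densities := hm.1
  have m2 : z₂ ∈ densities := hm.2.1
  have m3 : z₃ ∈ densities := hm.2.2
  have t1 : Tendsto (fun n => q₁ (φ n)) atTop (𝓝 z₁) := (continuous_fst.tendsto _).comp hz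
  have t2 : Tendsto (fun n => q₂ (φ n)) atTop (𝓝 z₂) :=
    ((continuous_fst.comp continuous_snd).tendsto _).comp hz
  have t3 : Tendsto (fun n => q₃ (φ n)) atTop (𝓝 z₃) :=
    ((continuous_snd.comp continuous_snd).tendsto _).comp hz
  have tp : Tendsto (fun n => p (φ n)) atTop (𝓝 c) := hpc.comp hφ.tendsto_atTop
  have tp1 := (continuous_fst.tendsto c).comp tp
  have tp2 := (continuous_snd.tendsto c).comp tp
  have tp3 := (tendsto_const_nhds (x := (1 : ℝ))).sub tp1 |>.sub tp2
  have hΦ := continuous_Phi₁ d lam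
  have elim := tendsto_nhds_unique
    (((tp1.smul t1).add (tp2.smul t2)).add (tp3.smul t3))
    (tp.congr fun n => (e (φ n)).symm)
  have hlim := le_of_tendsto_of_tendsto' ((hΦ.tendsto c).comp tp)
    (((tp1.mul ((hΦ.tendsto _).comp t1)).add (tp2.mul ((hΦ.tendsto _).comp t2))).add
      (tp3.mul ((hΦ.tendsto _).comp t3))) fun n => hle (φ n)
  obtain ⟨c1, c2, c3, -⟩ := hconc
  have b1 := hc.2 z₁ m1
  have b2 := hc.2 z₂ m2
  have b3 := hc.2 z₃ m3
  have s1 := mul_le_mul_of_nonneg_left b1 c1.le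
  have s2 := mul_le_mul_of_nonneg_left b2 c2.le
  have s3 := mul_le_mul_of_nonneg_left b3 c3.le
  have g : ∀ {z}, z ∈ densities → Phi₁ d lam c ≤ Phi₁ d lam z → z = c ∨ z = c.swap :=
    fun hz hle => hmax _ ⟨hz, fun q hq => (hc.2 q hq).trans hle⟩
  have g1 := g m1 (le_of_mul_le_mul_left (by linarith) c1)
  have g2 := g m2 (le_of_mul_le_mul_left (by linarith) c2)
  have g3 := g m3 (le_of_mul_le_mul_left (by linarith) c3)
  have elim1 : c.1 * z₁.1 + c.2 * z₂.1 + (1 - c.1 - c.2) * z₃.1 = c.1 := congrArg Prod.fst elim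
  -- Among the two maximizers c has the larger first coordinate, so a mean equal to c with positive
  -- weights forces every limit to be c.
  have f : ∀ {z : ℝ × ℝ}, z = c ∨ z = c.swap → z.1 ≤ c.1 ∧ (c.1 ≤ z.1 → z = c) := by
    rintro z (rfl | rfl)
    · exact ⟨le_rfl, fun _ => rfl⟩
    · exact ⟨hlt.le, fun hh => absurd hlt (not_lt.2 hh)⟩
  obtain ⟨f1, f1'⟩ := f g1
  obtain ⟨f2, f2'⟩ := f g2
  obtain ⟨f3, f3'⟩ := f g3
  have r1 := mul_le_mul_of_nonneg_left f1 c1.le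
  have r2 := mul_le_mul_of_nonneg_left f2 c2.le
  have r3 := mul_le_mul_of_nonneg_left f3 c3.le
  rw [f1' (le_of_mul_le_mul_left (by linarith) c1)] at t1
  rw [f2' (le_of_mul_le_mul_left (by linarith) c2)] at t2
  rw [f3' (le_of_mul_le_mul_left (by linarith) c3)] at t3
  have hev := (t1.eventually (Metric.ball_mem_nhds _ hr)).and
    ((t2.eventually (Metric.ball_mem_nhds _ hr)).and (t3.eventually (Metric.ball_mem_nhds _ hr)))
  obtain ⟨n, w1, w2, w3⟩ := hev.exists
  have hpn : p (φ n) ∈ Metric.ball c r := Metric.ball_subset_ball (min_le_left _ _) (hp _)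
  obtain ⟨k1, k2, k3, -⟩ := hball _ hpn
  -- For this n all the points lie in the ball of strict concavity. Averaging the tangent
  -- inequalities cancels the linear terms, and any qᵢ ≠ p makes the result strict.
  have tang : ∀ q ∈ Metric.ball c r, Phi₁ d lam q ≤ Phi₁ d lam (p (φ n))
      + ((q.1 - (p (φ n)).1) * slope₁ d lam (p (φ n)).1 (p (φ n)).2
        + (q.2 - (p (φ n)).2) * slope₁ d lam (p (φ n)).2 (p (φ n)).1) ∧
      (q ≠ p (φ n) → Phi₁ d lam q < Phi₁ d lam (p (φ n))
      + ((q.1 - (p (φ n)).1) * slope₁ d lam (p (φ n)).1 (p (φ n)).2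
        + (q.2 - (p (φ n)).2) * slope₁ d lam (p (φ n)).2 (p (φ n)).1)) := by
    intro q hq
    by_cases hqp : q = p (φ n)
    · subst hqp
      simp
    · have := Phi₁_lt_tangent (lam := lam) hball hpn hq hqp
      exact ⟨this.le, fun _ => this⟩
  have e1 := congrArg Prod.fst (e (φ n))
  have e2 := congrArg Prod.snd (e (φ n))
  simp only [Prod.fst_add, Prod.snd_add, Prod.smul_fst, Prod.smul_snd, smul_eq_mul] at e1 e2
  have hn := hle (φ n)
  have hnn := hne (φ n)
  obtain ⟨l1, l1'⟩ := tang _ w1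
  obtain ⟨l2, l2'⟩ := tang _ w2
  obtain ⟨l3, l3'⟩ := tang _ w3
  generalize slope₁ d lam (p (φ n)).1 (p (φ n)).2 = D₁ at *
  generalize slope₁ d lam (p (φ n)).2 (p (φ n)).1 = D₂ at *
  have v1 := mul_le_mul_of_nonneg_left l1 k1.le
  have v2 := mul_le_mul_of_nonneg_left l2 k2.le
  have v3 := mul_le_mul_of_nonneg_left l3 k3.le
  have hsum : (p (φ n)).1 * (Phi₁ d lam (p (φ n)) + (((q₁ (φ n)).1 - (p (φ n)).1) * D₁
        + ((q₁ (φ n)).2 - (p (φ n)).2) * D₂))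
      + (p (φ n)).2 * (Phi₁ d lam (p (φ n)) + (((q₂ (φ n)).1 - (p (φ n)).1) * D₁
        + ((q₂ (φ n)).2 - (p (φ n)).2) * D₂))
      + (1 - (p (φ n)).1 - (p (φ n)).2) * (Phi₁ d lam (p (φ n))
        + (((q₃ (φ n)).1 - (p (φ n)).1) * D₁ + ((q₃ (φ n)).2 - (p (φ n)).2) * D₂))
      = Phi₁ d lam (p (φ n)) := by
    linear_combination D₁ * e1 + D₂ * e2
  apply hnn
  refine ⟨?_, ?_, ?_⟩
  · by_contra hh
    have := mul_lt_mul_of_pos_left (l1' hh) k1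
    linarith
  · by_contra hh
    have := mul_lt_mul_of_pos_left (l2' hh) k2
    linarith
  · by_contra hh
    have := mul_lt_mul_of_pos_left (l3' hh) k3
    linarith

/-! ### The second moment exponent as an average of first moment exponents -/

section SecondMoment

theorem entropyH₁_eq (x y : ℝ) :
    entropyH₁ x y = negMulLog x + negMulLog (y - x) - negMulLog y := by
  simp only [entropyH₁, negMulLog]
  ring

theorem entropyH_eq (x : ℝ) : entropyH x = negMulLog x + negMulLog (1 - x) := by
  simp only [entropyH, negMulLog]
  ring

theorem entropyH₁_mul (t m : ℝ) :
    entropyH₁ (t * m) m = m * (negMulLog t + negMulLog (1 - t)) := by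
  rw [entropyH₁_eq, show m - t * m = (1 - t) * m by ring, Real.negMulLog_mul, Real.negMulLog_mul]
  ring

/-- By `entropyH₁_mul` each term is a mass times the binary entropy of a fraction, so this is
concavity of binary entropy with weights proportional to the masses. -/
theorem entropyH₁_add_le {p₁ p₂ m₁ m₂ : ℝ} (h₁ : 0 ≤ p₁) (h₁' : p₁ ≤ m₁) (h₂ : 0 ≤ p₂)
    (h₂' : p₂ ≤ m₂) (hm₁ : 0 < m₁) (hm₂ : 0 < m₂) :
    entropyH₁ p₁ m₁ + entropyH₁ p₂ m₂ ≤ entropyH₁ (p₁ + p₂) (m₁ + m₂) := by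
  have hm : 0 < m₁ + m₂ := by linarith
  obtain ⟨t₁, rfl⟩ : ∃ t, p₁ = t * m₁ := ⟨p₁ / m₁, by field_simp⟩
  obtain ⟨t₂, rfl⟩ : ∃ t, p₂ = t * m₂ := ⟨p₂ / m₂, by field_simp⟩
  have a1 : 0 ≤ t₁ := nonneg_of_mul_nonneg_left h₁ hm₁
  have a2 : 0 ≤ t₂ := nonneg_of_mul_nonneg_left h₂ hm₂
  have b1 : 0 ≤ 1 - t₁ := by
    have : t₁ * m₁ ≤ 1 * m₁ := by linarith
    linarith [le_of_mul_le_mul_right this hm₁]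
  have b2 : 0 ≤ 1 - t₂ := by
    have : t₂ * m₂ ≤ 1 * m₂ := by linarith
    linarith [le_of_mul_le_mul_right this hm₂]
  have e : t₁ * m₁ + t₂ * m₂
      = (m₁ / (m₁ + m₂) * t₁ + m₂ / (m₁ + m₂) * t₂) * (m₁ + m₂) := by
    field_simp
  have hs : m₁ / (m₁ + m₂) + m₂ / (m₁ + m₂) = 1 := by field_simp
  have c1 := Real.concaveOn_negMulLog.2 a1 a2 (by positivity : 0 ≤ m₁ / (m₁ + m₂))
    (by positivity : 0 ≤ m₂ / (m₁ + m₂)) hs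
  have c2 := Real.concaveOn_negMulLog.2 b1 b2 (by positivity : 0 ≤ m₁ / (m₁ + m₂))
    (by positivity : 0 ≤ m₂ / (m₁ + m₂)) hs
  simp only [smul_eq_mul] at c1 c2
  have e2 : m₁ / (m₁ + m₂) * (1 - t₁) + m₂ / (m₁ + m₂) * (1 - t₂)
      = 1 - (m₁ / (m₁ + m₂) * t₁ + m₂ / (m₁ + m₂) * t₂) := by
    linear_combination hs
  rw [e2] at c2
  rw [e, entropyH₁_mul, entropyH₁_mul, entropyH₁_mul]
  generalize m₁ / (m₁ + m₂) * t₁ + m₂ / (m₁ + m₂) * t₂ = t at *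
  have c3 := mul_le_mul_of_nonneg_left (add_le_add c1 c2) hm.le
  refine le_trans (le_of_eq ?_) c3
  field_simp
  ring

/-- A choice from a set with two parts is made proportionally from the parts. -/
theorem exists_entropyH₁_split {A N₁ N₂ : ℝ} (hA : 0 ≤ A) (h₁ : 0 ≤ N₁) (h₂ : 0 ≤ N₂)
    (h : A ≤ N₁ + N₂) : ∃ e, 0 ≤ e ∧ e ≤ N₁ ∧ e ≤ A ∧ A - e ≤ N₂ ∧
      entropyH₁ A (N₁ + N₂) = entropyH₁ e N₁ + entropyH₁ (A - e) N₂ := by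
  rcases (add_nonneg h₁ h₂).eq_or_lt with h0 | h0
  · obtain rfl : N₁ = 0 := by linarith
    obtain rfl : N₂ = 0 := by linarith
    obtain rfl : A = 0 := by linarith
    exact ⟨0, by simp, by simp, by simp, by simp, by simp [entropyH₁]⟩
  · obtain ⟨t, rfl⟩ : ∃ t, A = t * (N₁ + N₂) := ⟨A / (N₁ + N₂), by field_simp⟩
    have ht0 : 0 ≤ t := nonneg_of_mul_nonneg_left hA h0
    have ht1 : t ≤ 1 := le_of_mul_le_mul_right (by linarith) h0
    have e : t * (N₁ + N₂) - t * N₁ = t * N₂ := by ring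
    refine ⟨t * N₁, by positivity, mul_le_of_le_one_left h₁ ht1, ?_, ?_, ?_⟩
    · nlinarith
    · rw [e]
      exact mul_le_of_le_one_left h₂ ht1
    · rw [e, entropyH₁_mul, entropyH₁_mul, entropyH₁_mul]
      ring

variable {d : ℕ} {lam : ℝ}

/-- `Phi₁` is homogeneous. -/
theorem mul_Phi₁_div (u v : ℝ) {m : ℝ} (hm : 0 < m) :
    m * Phi₁ d lam (u / m, v / m) = (u + v) * Real.log lam + negMulLog u + negMulLog v
      + (d + 1) * negMulLog (m - u - v) - d * (negMulLog (m - u) + negMulLog (m - v))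
      + (d - 1) * negMulLog m := by
  obtain ⟨a, rfl⟩ : ∃ a, u = a * m := ⟨u / m, by field_simp⟩
  obtain ⟨b, rfl⟩ : ∃ b, v = b * m := ⟨v / m, by field_simp⟩
  rw [mul_div_cancel_right₀ _ hm.ne', mul_div_cancel_right₀ _ hm.ne',
    show m - a * m - b * m = (1 - a - b) * m by ring, show m - a * m = (1 - a) * m by ring,
    show m - b * m = (1 - b) * m by ring]
  simp only [Real.negMulLog_mul, Phi₁]
  ring

/-- The second moment exponent in terms of the first moment exponents of the conditional laws. -/
theorem Phi₂_eq {α β γ δ ε e : ℝ} (hα : 0 < α) (hβ : 0 < β) (hαβ : 0 < 1 - α - β)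
    (he : entropyH₁ (α - γ) ((1 - 2 * β + δ - γ - ε) + (β - δ))
      = entropyH₁ e (1 - 2 * β + δ - γ - ε) + entropyH₁ (α - γ - e) (β - δ)) :
    Phi₂ (d + 1) lam α β γ δ ε = Phi₁ d lam (α, β)
      + (α * Phi₁ d lam (γ / α, (α - γ - ε) / α)
        + β * Phi₁ d lam ((α - γ - e) / β, δ / β)
        + (1 - α - β) * Phi₁ d lam (e / (1 - α - β), (β - δ - α + γ + ε) / (1 - α - β)))
      - d * ((entropyH₁ ((α - γ - e) + e) (β + (1 - α - β))
          - (entropyH₁ (α - γ - e) β + entropyH₁ e (1 - α - β)))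
        + (entropyH₁ ((α - γ - ε) + (β - δ - α + γ + ε)) (α + (1 - α - β))
          - (entropyH₁ (α - γ - ε) α + entropyH₁ (β - δ - α + γ + ε) (1 - α - β)))) := by
  rw [mul_Phi₁_div _ _ hα, mul_Phi₁_div _ _ hβ, mul_Phi₁_div _ _ hαβ, Phi₂,
    show 1 - β - γ - ε = (1 - 2 * β + δ - γ - ε) + (β - δ) by ring, he]
  simp only [entropyH₁_eq, entropyH_eq, Phi₁]
  push_cast
  ring_nf

theorem product_mem_region {α β : ℝ} (hα : 0 < α) (hβ : 0 < β) (hαβ : 0 < 1 - α - β) :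
    (α ^ 2, β ^ 2, α * (1 - α - β)) ∈ region α β := by
  have h1 := mul_pos hα hβ
  have h2 := mul_pos hα hαβ
  have h3 := mul_pos hβ hαβ
  refine ⟨by positivity, by positivity, h2.le, ?_, ?_, ?_, ?_, ?_⟩ <;> simp only <;> nlinarith

/-- All three conditional laws equal (α,β), and both entropy corrections compare proportional
splits, hence vanish. The proportional choice of e is α(1-α-β), the fraction being α/(1-β). -/
theorem Phi₂_product {α β : ℝ} (hα : 0 < α) (hβ : 0 < β) (hαβ : 0 < 1 - α - β) :
    Phi₂ (d + 1) lam α β (α ^ 2) (β ^ 2) (α * (1 - α - β)) = 2 * Phi₁ d lam (α, β) := by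
  have hα' : 0 < 1 - α := by linarith
  have hβ' : 0 < 1 - β := by linarith
  rw [Phi₂_eq (e := α * (1 - α - β)) hα hβ hαβ]
  · have e1 : α ^ 2 / α = α := by field_simp
    have e2 : (α - α ^ 2 - α * (1 - α - β)) / α = β := by
      field_simp
      ring
    have e3 : (α - α ^ 2 - α * (1 - α - β)) / β = α := by
      field_simp
      ring
    have e4 : β ^ 2 / β = β := by field_simp
    have e5 : α * (1 - α - β) / (1 - α - β) = α := by field_simp
    have e6 : (β - β ^ 2 - α + α ^ 2 + α * (1 - α - β)) / (1 - α - β) = β := by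
      field_simp
      ring
    have e7 : α - α ^ 2 - α * (1 - α - β) = α * β := by ring
    have e8 : β - β ^ 2 - α + α ^ 2 + α * (1 - α - β) = β * (1 - α - β) := by ring
    rw [e1, e2, e3, e4, e5, e6, e7, e8, mul_comm α β, ← mul_add β, mul_comm β α, ← mul_add α]
    rw [entropyH₁_mul, entropyH₁_mul, entropyH₁_mul, mul_comm α β, entropyH₁_mul, entropyH₁_mul,
      entropyH₁_mul]
    ring
  · have hsplit : ∀ t N₁ N₂ : ℝ, entropyH₁ (t * (N₁ + N₂)) (N₁ + N₂)
        = entropyH₁ (t * N₁) N₁ + entropyH₁ (t * N₂) N₂ := by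
      intro t N₁ N₂
      rw [entropyH₁_mul, entropyH₁_mul, entropyH₁_mul]
      ring
    have h := hsplit (α / (1 - β)) (1 - 2 * β + β ^ 2 - α ^ 2 - α * (1 - α - β)) (β - β ^ 2)
    have e1 : α / (1 - β) * (1 - 2 * β + β ^ 2 - α ^ 2 - α * (1 - α - β) + (β - β ^ 2))
        = α - α ^ 2 := by
      field_simp
      ring
    have e2 : α / (1 - β) * (1 - 2 * β + β ^ 2 - α ^ 2 - α * (1 - α - β))
        = α * (1 - α - β) := by
      field_simp
      ring
    have e3 : α / (1 - β) * (β - β ^ 2) = α - α ^ 2 - α * (1 - α - β) := by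
      field_simp
      ring
    rwa [e1, e2, e3] at h

theorem div_mem_densities {u v m : ℝ} (hm : 0 < m) (hu : 0 ≤ u) (hv : 0 ≤ v) (h : u + v ≤ m) :
    (u / m, v / m) ∈ densities :=
  ⟨by simp only; positivity, by simp only; positivity, by
    simp only
    rw [← add_div, div_le_one hm]
    exact h⟩

/-- If no splitting of the densities improves the first moment exponent, then the second moment
exponent is maximal at the product point. -/
theorem isUniqueMaxOn_Phi₂ {α β : ℝ} (hα : 0 < α) (hβ : 0 < β) (hαβ : 0 < 1 - α - β)
    (h : ∀ q₁ ∈ densities, ∀ q₂ ∈ densities, ∀ q₃ ∈ densities,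
        α • q₁ + β • q₂ + (1 - α - β) • q₃ = (α, β) →
        ¬(q₁ = (α, β) ∧ q₂ = (α, β) ∧ q₃ = (α, β)) →
        α * Phi₁ d lam q₁ + β * Phi₁ d lam q₂ + (1 - α - β) * Phi₁ d lam q₃
          < Phi₁ d lam (α, β)) :
    IsUniqueMaxOn (fun x : ℝ × ℝ × ℝ => Phi₂ (d + 1) lam α β x.1 x.2.1 x.2.2) (region α β)
        (α ^ 2, β ^ 2, α * (1 - α - β)) := by
  refine ⟨product_mem_region hα hβ hαβ, ?_⟩
  rintro ⟨γ, δ, ε⟩ ⟨r1, r2, r3, r4, r5, r6, r7, r8⟩ hne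
  simp only at r1 r2 r3 r4 r5 r6 r7 r8
  change Phi₂ (d + 1) lam α β γ δ ε
    < Phi₂ (d + 1) lam α β (α ^ 2) (β ^ 2) (α * (1 - α - β))
  -- Here e is the mass of edges empty for the first set whose plus end the second set occupies. The
  -- exponent fixes only γ, δ, ε, and the proportional split supplies e.
  obtain ⟨e, he0, he1, he2, he3, he⟩ := exists_entropyH₁_split (A := α - γ)
    (N₁ := 1 - 2 * β + δ - γ - ε) (N₂ := β - δ) (by linarith) r6 r5 (by linarith)
  rw [Phi₂_product hα hβ hαβ, Phi₂_eq hα hβ hαβ he]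
  have hX := entropyH₁_add_le (p₁ := α - γ - e) (m₁ := β) (p₂ := e) (m₂ := 1 - α - β)
    (by linarith) (by linarith) he0 (by linarith) hβ hαβ
  have hY := entropyH₁_add_le (p₁ := α - γ - ε) (m₁ := α) (p₂ := β - δ - α + γ + ε)
    (m₂ := 1 - α - β) r4 (by linarith) (by linarith) (by linarith) hα hαβ
  have hlt := h (γ / α, (α - γ - ε) / α) (div_mem_densities hα r1 r4 (by linarith))
    ((α - γ - e) / β, δ / β) (div_mem_densities hβ (by linarith) r2 (by linarith))
    (e / (1 - α - β), (β - δ - α + γ + ε) / (1 - α - β))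
    (div_mem_densities hαβ he0 (by linarith) (by linarith)) ?_ ?_
  · have := mul_nonneg (Nat.cast_nonneg (α := ℝ) d) (add_nonneg (sub_nonneg.2 hX)
      (sub_nonneg.2 hY))
    linarith
  · ext
    · simp only [Prod.fst_add, Prod.smul_fst, smul_eq_mul]
      rw [mul_div_cancel₀ _ hα.ne', mul_div_cancel₀ _ hβ.ne', mul_div_cancel₀ _ hαβ.ne']
      ring
    · simp only [Prod.snd_add, Prod.smul_snd, smul_eq_mul]
      rw [mul_div_cancel₀ _ hα.ne', mul_div_cancel₀ _ hβ.ne', mul_div_cancel₀ _ hαβ.ne']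
      ring
  -- The first two conditional laws already determine γ, ε and δ, so if they were trivial the point
  -- would be the product point.
  · rintro ⟨h1, h2, -⟩
    simp only [Prod.mk.injEq] at h1 h2
    have g1 := (div_eq_iff hα.ne').1 h1.1
    have g2 := (div_eq_iff hα.ne').1 h1.2
    have g3 := (div_eq_iff hβ.ne').1 h2.2
    apply hne
    ext
    · simp only; linarith
    · simp only; linarith
    · simp only; linarith

end SecondMoment

/-- Sly's condition holds at every activity above the critical one. -/
theorem slyCondition_of_lambdaC_lt {Δ : ℕ} (hΔ : 3 ≤ Δ) {lam : ℝ} (hlam : lambdaC Δ < lam) :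
    SlyCondition Δ lam := by
  obtain ⟨d, rfl⟩ : ∃ d, Δ = d + 1 := ⟨Δ - 1, by omega⟩
  have hd : 2 ≤ d := by omega
  have hd' : (2 : ℝ) ≤ d := by exact_mod_cast hd
  have hlam0 : 0 < lam := by
    refine lt_of_le_of_lt ?_ hlam
    rw [lambdaC]
    push_cast
    exact div_nonneg (pow_nonneg (by linarith) _) (pow_nonneg (by linarith) _)
  obtain ⟨x, y, hxy, hmax, huniq⟩ := exists_isTwoCycle_isMaximizer hd hlam0 hlam
  have hy := hxy.pos
  have hx := hy.trans hxy.lt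
  obtain ⟨t1, t2⟩ := hxy.tendsto_rootOccupation hd
  have hlt : (cycleDensities x y).2 < (cycleDensities x y).1 := by
    simp only [cycleDensities]
    have := hxy.lt
    gcongr
  obtain ⟨χ, hχ, h⟩ := exists_strict_jensen hmax hlt (hxy.isConcaveAt hd) huniq
  refine ⟨_, _, t1, t2, χ, hχ, fun α β hα hβ => ?_⟩
  obtain ⟨h1, h2, h3, h4⟩ := h (α, β) (by
    rw [Metric.mem_ball, Prod.dist_eq, max_lt_iff, Real.dist_eq, Real.dist_eq, abs_sub_comm α,
      abs_sub_comm β]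
    exact ⟨hα, hβ⟩)
  exact isUniqueMaxOn_Phi₂ h1 h2 h3 h4

/-! ### The activity `λ_{1/2}` -/

theorem phi_half {d : ℕ} {u : ℝ} (hu : 0 < u) :
    phi (d + 1) (u ^ (d + 1))⁻¹ (1 / 2) = (1 - u) / 2 := by
  have e : (1 / 2 : ℝ) / ((u ^ (d + 1))⁻¹ * (1 - 1 / 2)) = u ^ (d + 1) := by
    field_simp
    norm_num
  rw [phi, e, one_div ((d + 1 : ℕ) : ℝ), Real.pow_rpow_inv_natCast hu.le (by omega)]
  ring

/-- Writing λ = u^(-(d+1)) extracts u from each root in φ; one root remains, and raising to the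
power d + 1 removes it. -/
theorem phi_phi_half_eq_iff {d : ℕ} {u : ℝ} (hu : 0 < u) (hu1 : u ≤ 1) :
    phi (d + 1) (u ^ (d + 1))⁻¹ (phi (d + 1) (u ^ (d + 1))⁻¹ (1 / 2)) = 1 / 2
      ↔ (1 - u) * (1 + u) ^ d = 1 := by
  have hr : 0 ≤ (1 - u) / (1 + u) := div_nonneg (by linarith) (by linarith)
  have e : (1 - u) / 2 / ((u ^ (d + 1))⁻¹ * (1 - (1 - u) / 2))
      = u ^ (d + 1) * ((1 - u) / (1 + u)) := by
    have h1 : 1 - (1 - u) / 2 = (1 + u) / 2 := by ring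
    rw [h1]
    field_simp
  rw [phi_half hu, phi, e, Real.mul_rpow (by positivity) hr, one_div ((d + 1 : ℕ) : ℝ),
    Real.pow_rpow_inv_natCast hu.le (by omega)]
  have h1 : (1 - (1 - u) / 2) * (1 - u * ((1 - u) / (1 + u)) ^ (((d + 1 : ℕ) : ℝ)⁻¹)) = 1 / 2
      ↔ ((1 - u) / (1 + u)) ^ (((d + 1 : ℕ) : ℝ)⁻¹) = (1 + u)⁻¹ := by
    generalize ((1 - u) / (1 + u)) ^ (((d + 1 : ℕ) : ℝ)⁻¹) = s
    rw [← mul_eq_one_iff_eq_inv₀ (by positivity)]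
    constructor
    · intro h
      refine mul_left_cancel₀ hu.ne' ?_
      linear_combination -2 * h
    · intro h
      linear_combination -u / 2 * h
  rw [h1, Real.rpow_inv_eq hr (by positivity) (by positivity), Real.rpow_natCast, inv_pow,
    ← mul_eq_one_iff_eq_inv₀ (by positivity), pow_succ]
  have h2 : (1 - u) / (1 + u) * ((1 + u) ^ d * (1 + u)) = (1 - u) * (1 + u) ^ d := by
    field_simp
  rw [h2]

/-- The critical activity is less than one from degree six on. -/
theorem lambdaC_lt_one {n : ℕ} (hn : 4 ≤ n) : lambdaC (n + 2) < 1 := by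
  have hn' : (4 : ℝ) ≤ n := by exact_mod_cast hn
  have hn0 : (0 : ℝ) < n := by linarith
  -- The left side is at most exp((n+1)/n) ≤ exp(5/4) < 4 ≤ n, the middle bound because e⁵ < 4⁴.
  have h1 : (1 + 1 / (n : ℝ)) ^ (n + 1) < n := by
    have h2 : (1 + 1 / (n : ℝ)) ^ (n + 1) ≤ Real.exp (1 / n) ^ (n + 1) := by
      gcongr
      rw [add_comm]
      exact Real.add_one_le_exp _
    have h3 : Real.exp (1 / n) ^ (n + 1) ≤ Real.exp (5 / 4) := by
      rw [← Real.exp_nat_mul]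
      apply Real.exp_le_exp.2
      push_cast
      rw [mul_one_div, div_le_div_iff₀ hn0 (by norm_num)]
      linarith
    have h4 : Real.exp (5 / 4) < 4 := by
      refine lt_of_pow_lt_pow_left₀ 4 (by norm_num) ?_
      rw [← Real.exp_nat_mul, show ((4 : ℕ) : ℝ) * (5 / 4) = (5 : ℕ) * 1 by norm_num,
        Real.exp_nat_mul]
      calc Real.exp 1 ^ 5 < 2.7182818286 ^ 5 := by
            have := Real.exp_one_lt_d9
            gcongr
        _ < 4 ^ 4 := by norm_num
    linarith
  rw [lambdaC, show n + 2 - 1 = n + 1 by omega]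
  push_cast
  rw [show (n : ℝ) + 2 - 1 = n + 1 by ring, show (n : ℝ) + 2 - 2 = n by ring,
    div_lt_one (by positivity), pow_succ (n : ℝ) (n + 1)]
  rw [one_add_div hn0.ne', div_pow, div_lt_iff₀ (by positivity)] at h1
  linarith

theorem exists_isLambdaHalf {Δ : ℕ} (hΔ : 6 ≤ Δ) :
    ∃ L, IsLambdaHalf Δ L ∧ lambdaC (Δ - 1) < L := by
  obtain ⟨d, rfl⟩ : ∃ d, Δ = d + 1 := ⟨Δ - 1, by omega⟩
  have hd : 5 ≤ d := by omega
  have hcont : Continuous fun u : ℝ => (1 - u) * (1 + u) ^ d := by fun_prop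
  -- The cutoff 1/2 discards the trivial root u = 0. The polynomial exceeds 1 at 1/2 when d ≥ 5 and
  -- vanishes at 1, so a root remains to the right.
  have hcpt : IsCompact (Set.Icc (1 / 2 : ℝ) 1 ∩ {u | (1 - u) * (1 + u) ^ d = 1}) :=
    isCompact_Icc.inter_right (isClosed_eq hcont continuous_const)
  obtain ⟨w, hw, hw1⟩ : (1 : ℝ) ∈ (fun u : ℝ => (1 - u) * (1 + u) ^ d) '' Set.Icc (1 / 2) 1 := by
    refine intermediate_value_Icc' (by norm_num) hcont.continuousOn ⟨by simp, ?_⟩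
    have : (3 / 2 : ℝ) ^ 5 ≤ (3 / 2 : ℝ) ^ d := pow_le_pow_right₀ (by norm_num) hd
    norm_num at this ⊢
    linarith
  obtain ⟨u, ⟨⟨hu1, hu2⟩, hu⟩, hmax⟩ := hcpt.exists_isGreatest ⟨w, hw, hw1⟩
  have hu0 : 0 < u := by linarith
  replace hu : (1 - u) * (1 + u) ^ d = 1 := hu
  have hu3 : u < 1 := lt_of_le_of_ne hu2 (by rintro rfl; simp at hu)
  refine ⟨(u ^ (d + 1))⁻¹, ⟨⟨by positivity, ?_, (phi_phi_half_eq_iff hu0 hu2).2 hu⟩, ?_⟩, ?_⟩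
  · rw [phi_half hu0]
    constructor <;> linarith
  · rintro lam ⟨hlam, hmem, heq⟩
    obtain ⟨v, hv, rfl⟩ : ∃ v : ℝ, 0 < v ∧ (v ^ (d + 1))⁻¹ = lam := by
      refine ⟨lam⁻¹ ^ (((d + 1 : ℕ) : ℝ)⁻¹), by positivity, ?_⟩
      rw [Real.rpow_inv_natCast_pow (by positivity) (by omega), inv_inv]
    rw [phi_half hv] at hmem
    have hv1 : v ≤ 1 := by linarith [hmem.1]
    have hv2 := (phi_phi_half_eq_iff hv hv1).1 heq
    have hvu : v ≤ u := by
      by_contra! hc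
      exact absurd (hmax ⟨⟨by linarith, hv1⟩, hv2⟩) (not_le.2 hc)
    gcongr
  · rw [Nat.add_sub_cancel]
    -- For Δ = 6 the bound λ_c(5) = 256/243 exceeds 1, so u < 0.98 is needed. For larger Δ, λ_c(Δ-1)
    -- < 1 < u^(-Δ) suffices.
    rcases hd.eq_or_lt with rfl | hd'
    · have hu4 : u < 98 / 100 := by
        by_contra! hc
        have h1 : (1 + u) ^ 5 ≤ 2 ^ 5 := by gcongr; linarith
        have h2 := mul_le_mul (by linarith : 1 - u ≤ 2 / 100) h1 (by positivity) (by norm_num)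
        rw [hu] at h2
        norm_num at h2
      have h3 : u ^ (5 + 1) < (98 / 100) ^ (5 + 1) := by gcongr
      rw [lambdaC, lt_inv_comm₀ (by norm_num) (by positivity)]
      refine h3.trans ?_
      norm_num
    · obtain ⟨n, rfl⟩ : ∃ n, d = n + 2 := ⟨d - 2, by omega⟩
      refine (lambdaC_lt_one (by omega)).trans ?_
      exact (one_lt_inv₀ (by positivity)).2 (pow_lt_one₀ hu0.le hu3 (by omega))

end HardCore

theorem corollary4 :
    (∀ lam : ℝ, HardCore.lambdaC 3 < lam → HardCore.SlyCondition 3 lam) ∧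
    (∀ Δ : ℕ, 6 ≤ Δ → ∃ L : ℝ, HardCore.IsLambdaHalf Δ L ∧
      HardCore.lambdaC (Δ - 1) < L ∧
      ∀ lam : ℝ, HardCore.lambdaC Δ < lam → lam ≤ L → HardCore.SlyCondition Δ lam) ∧
    (∀ lam : ℝ, HardCore.lambdaC 5 < lam → lam ≤ HardCore.lambdaC 5 + 0.402912 →
      HardCore.SlyCondition 5 lam) ∧
    (∀ lam : ℝ, HardCore.lambdaC 4 < lam → lam ≤ HardCore.lambdaC 4 + 0.327887 →
      HardCore.SlyCondition 4 lam) := by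
  refine ⟨fun lam h => HardCore.slyCondition_of_lambdaC_lt le_rfl h, fun Δ hΔ => ?_,
    fun lam h _ => HardCore.slyCondition_of_lambdaC_lt (by norm_num) h,
    fun lam h _ => HardCore.slyCondition_of_lambdaC_lt (by norm_num) h⟩
  obtain ⟨L, h1, h2⟩ := HardCore.exists_isLambdaHalf hΔ
  exact ⟨L, h1, h2, fun lam h _ => HardCore.slyCondition_of_lambdaC_lt (by omega) h⟩
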